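/- Let $d\in\mathbb N_0$, $\hbar>0$, $z=(q,p)\in\mathbb R^d\times\mathbb R^d$, and let $S=\begin{bmatrix}A&B\\ C&D\end{bmatrix}\in \mathrm{Sp}(2d,\mathbb R)$ be a symplectic matrix ($S^TJS=J$ with $J=\begin{bmatrix}0&I\\-I&0\end{bmatrix}$). Put $Q=A+iB$ and $P=C+iD$. On the Schwartz space $\mathscr S(\mathbb R^d)$ let $\hat x_jf=x_jf$, $\hat p_jf=-i\hbar\,\partial f/\partial x_j$ and $\hat a_j^*=(2\hbar)^{-1/2}(\hat x_j-i\hat p_j)$. Let $\psi_0(x)=(\pi\hbar)^{-d/4}e^{-|x|^2/(2\hbar)}$, and let $\widehat T_z$ be the Heisenberg--Weyl operator $(\widehat T_zf)(x)=e^{\frac i\hbar p\cdot(x-q/2)}f(x-q)$ on $L^2(\mathbb R^d)$. Let $\mathrm{Mp}(2d,\mathbb R)$ be the metaplectic group, i.e. the group of unitary operators on $L^2(\mathbb R^d)$ generated by $\widehat J\psi(x)=(2\pi\hbar i)^{-d/2}\int_{\mathbb R^d} e^{-\frac i\hbar x\cdot y}\psi(y)\,dy$, $\widehat V_R\psi(x)=e^{\frac{i}{2\hbar}x^TRx}\psi(x)$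 ($R$ real symmetric), and $\widehat M_L^m\psi(x)=i^m|\det L|^{1/2}\psi(Lx)$ ($L\in \mathrm{GL}(d,\mathbb R)$, $m\pi\equiv\arg\det L$ mod $2\pi$), with its projection to $\mathrm{Sp}(2d,\mathbb R)$, the homomorphism given by $\widehat J\mapsto J$, $\widehat V_R\mapsto\begin{bmatrix}I&0\\R&I\end{bmatrix}$, $\widehat M_L^m\mapsto\begin{bmatrix}L^{-1}&0\\0&L^T\end{bmatrix}$. The Hagedorn wave packets $\{\varphi_n(S,z;\cdot)\}_{n\in\mathbb N_0^d}$ are the functions obtained from the ground state $\varphi_0$ by $$\varphi_{n+e_j}=\frac1{\sqrt{n_j+1}}\,\mathscr A_j^*\varphi_n\qquad(n\in\mathbb N_0^d,\ 1\le j\le d),$$ where $\varphi_0$ and $\mathscr A^*$ are given in either of the following two ways: (a) through a metaplectic operator $\widehat S$ lying over $S$: $\varphi_0=e^{-\frac{i}{2\hbar}p\cdot q}\,\widehat T_z\widehat S\psi_0$ and $\mathscr A_j^*=\widehat T_z\widehat S\,\hat a_j^*\,\widehat S^*\widehat T_z^*$; (b) explicitly, with either choice of the square root $(\det Q)^{-1/2}$: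 $$\varphi_0(x)=\frac{(\det Q)^{-1/2}}{(\pi\hbar)^{d/4}}\exp\Big\{\frac i\hbar\Big[\tfrac12(x-q)^TPQ^{-1}(x-q)+p\cdot(x-q)\Big]\Big\},\qquad \mathscr A^*=\frac{i}{\sqrt{2\hbar}}\big[P^*(\hat x-q)-Q^*(\hat p-p)\big].$$ Then there is a metaplectic operator lying over $S$, and under (a), for every such $\widehat S$, as well as under (b), for each choice of the root, the recursion is well defined (there is exactly one family in $L^2(\mathbb R^d)$ with the given $\varphi_0$, all of whose members lie in the domains of the operators $\mathscr A_j^*$, that satisfies it for all $n$ and $j$), and the Hagedorn wave packets $\{\varphi_n(S,z;\cdot)\}_{n\in\mathbb N_0^d}$ form an orthonormal basis of $L^2(\mathbb R^d)$. -/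

import Mathlib

open MeasureTheory
open scoped SchwartzMap LineDeriv Matrix ENNReal

noncomputable section

namespace Hagedorn

/-- Configuration space `ℝ^d` with the Euclidean norm. -/
abbrev Conf (d : ℕ) : Type := EuclideanSpace ℝ (Fin d)

/-- The Schwartz space of complex-valued functions on `ℝ^d`. -/
abbrev Sch (d : ℕ) : Type := 𝓢(Conf d, ℂ)

/-- The Hilbert space `L²(ℝ^d)` of complex-valued functions. -/
abbrev L2 (d : ℕ) : Type := Lp ℂ 2 (volume : Measure (Conf d))

/-- Index set of `2d`-tuples: `Sum.inl j` is the `j`-th position slot and `Sum.inr j` the `j`-th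
momentum slot. -/
abbrev Phase (d : ℕ) : Type := Fin d ⊕ Fin d

/-! ### Position and momentum operators on the Schwartz space -/

/-- The position operator `f ↦ x_j f`. -/
def position {d : ℕ} (j : Fin d) : Module.End ℂ (Sch d) :=
  (SchwartzMap.smulLeftCLM ℂ (fun x : Conf d => ((x j : ℝ) : ℂ))).toLinearMap

theorem hasTemperateGrowth_coord {d : ℕ} (j : Fin d) :
    (fun x : Conf d => ((x j : ℝ) : ℂ)).HasTemperateGrowth :=
  (Complex.ofRealCLM ∘L (EuclideanSpace.proj (𝕜 := ℝ) j)).hasTemperateGrowth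

theorem position_apply {d : ℕ} (j : Fin d) (f : Sch d) (x : Conf d) :
    position j f x = ((x j : ℝ) : ℂ) * f x := by
  simp [position, hasTemperateGrowth_coord j]

/-- The momentum operator `f ↦ -i ħ ∂f/∂x_j`. -/
def momentum {d : ℕ} (ħ : ℝ) (j : Fin d) : Module.End ℂ (Sch d) :=
  (-(Complex.I * (ħ : ℂ))) •
    (LineDeriv.lineDerivOpCLM ℂ (Sch d) (EuclideanSpace.single j (1 : ℝ))).toLinearMap

theorem momentum_apply {d : ℕ} (ħ : ℝ) (j : Fin d) (f : Sch d) (x : Conf d) :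
    momentum ħ j f x = -(Complex.I * (ħ : ℂ)) * fderiv ℝ f x (EuclideanSpace.single j 1) :=
  rfl

/-- The `2d`-tuple `ẑ = (x̂, p̂)`. -/
def zHat {d : ℕ} (ħ : ℝ) : Phase d → Module.End ℂ (Sch d) :=
  Sum.elim position (momentum ħ)

/-- The shifted tuple `ẑ - z = (x̂ - q, p̂ - p)`. -/
def zHatShift {d : ℕ} (ħ : ℝ) (q p : Conf d) : Phase d → Module.End ℂ (Sch d) :=
  fun k => zHat ħ k - ((Sum.elim q.ofLp p.ofLp k : ℝ) : ℂ) • 1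

/-! ### Linear combinations and ladder operators -/

/-- The matrix `J = [[0, I], [-I, 0]]` over `R` (the negative of `Matrix.J`). -/
def bigJ (d : ℕ) (R : Type) [CommRing R] : Matrix (Phase d) (Phase d) R :=
  Matrix.fromBlocks 0 1 (-1) 0

/-- `ρ(X; ẑ) = Xᵀ J ẑ`, a `2d`-tuple of operators. The first `d` components form `ρ♭(X; ẑ)`, the
last `d` components form `ρ♯(X; ẑ)`. -/
def rho {d : ℕ} (X : Matrix (Phase d) (Phase d) ℂ) (zh : Phase d → Module.End ℂ (Sch d)) :
    Phase d → Module.End ℂ (Sch d) :=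
  fun k => ∑ l, (Xᵀ * bigJ d ℂ) k l • zh l

/-- `W_ħ = (2ħ)^{-1/2} [[i I, -i I], [-I, -I]]`. -/
def Wmat (d : ℕ) (ħ : ℝ) : Matrix (Phase d) (Phase d) ℂ :=
  ((√(2 * ħ) : ℝ) : ℂ)⁻¹ •
    Matrix.fromBlocks (Complex.I • 1) (-(Complex.I • 1)) (-1) (-1)

/-- The complex matrix `Q = A + i B` of the real block matrix `S = [[A, B], [C, D]]`. -/
def Qmat {d : ℕ} (S : Matrix (Phase d) (Phase d) ℝ) : Matrix (Fin d) (Fin d) ℂ :=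
  S.toBlocks₁₁.map (fun r : ℝ => (r : ℂ)) + Complex.I • S.toBlocks₁₂.map (fun r : ℝ => (r : ℂ))

/-- The complex matrix `P = C + i D` of the real block matrix `S = [[A, B], [C, D]]`. -/
def Pmat {d : ℕ} (S : Matrix (Phase d) (Phase d) ℝ) : Matrix (Fin d) (Fin d) ℂ :=
  S.toBlocks₂₁.map (fun r : ℝ => (r : ℂ)) + Complex.I • S.toBlocks₂₂.map (fun r : ℝ => (r : ℂ))

/-- The inclusion of the Schwartz space into `L²(ℝ^d)`. -/
def incl (d : ℕ) : Sch d →ₗ[ℂ] L2 d :=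
  (SchwartzMap.toLpCLM ℂ ℂ 2 (volume : Measure (Conf d))).toLinearMap

theorem incl_apply {d : ℕ} (f : Sch d) : incl d f = f.toLp 2 volume := rfl

theorem incl_injective (d : ℕ) : Function.Injective (incl d) :=
  SchwartzMap.injective_toLp 2 volume

/-- An operator on the Schwartz space, regarded as an unbounded operator in `L²(ℝ^d)` whose domain
is (the image of) the Schwartz space. -/
def onL2 {d : ℕ} (A : Module.End ℂ (Sch d)) : L2 d →ₗ.[ℂ] L2 d where
  domain := LinearMap.range (incl d)
  toFun := incl d ∘ₗ A ∘ₗ (LinearEquiv.ofInjective (incl d) (incl_injective d)).symm.toLinearMap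

theorem onL2_incl {d : ℕ} (A : Module.End ℂ (Sch d)) (f : Sch d) :
    onL2 A ⟨incl d f, LinearMap.mem_range_self _ f⟩ = incl d (A f) := by
  have h : (LinearEquiv.ofInjective (incl d) (incl_injective d)).symm
      ⟨incl d f, LinearMap.mem_range_self _ f⟩ = f := by
    rw [LinearEquiv.symm_apply_eq]
    rfl
  exact congrArg (fun g => incl d (A g)) h

/-- The conjugate `V A V*` of an unbounded operator by a unitary operator, with domain `V D(A)`. -/
def conjugate {d : ℕ} (V : L2 d ≃ₗᵢ[ℂ] L2 d) (A : L2 d →ₗ.[ℂ] L2 d) : L2 d →ₗ.[ℂ] L2 d where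
  domain := A.domain.comap V.symm.toLinearEquiv.toLinearMap
  toFun := V.toLinearEquiv.toLinearMap ∘ₗ A.toFun ∘ₗ
    V.symm.toLinearEquiv.toLinearMap.restrict (fun _ hx => hx)

theorem conjugate_apply {d : ℕ} (V : L2 d ≃ₗᵢ[ℂ] L2 d) (A : L2 d →ₗ.[ℂ] L2 d) (f : L2 d)
    (hf : V.symm f ∈ A.domain) : conjugate V A ⟨f, hf⟩ = V (A ⟨V.symm f, hf⟩) := rfl

/-! ### Heisenberg–Weyl operators -/

/-- The phase factor `e^{(i/ħ) p·(x - q/2)}`. -/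
def hwPhase {d : ℕ} (ħ : ℝ) (q p x : Conf d) : ℂ :=
  Complex.exp (Complex.I / (ħ : ℂ) * ((inner ℝ p (x - (1 / 2 : ℝ) • q) : ℝ) : ℂ))

theorem norm_hwPhase {d : ℕ} (ħ : ℝ) (q p x : Conf d) : ‖hwPhase ħ q p x‖ = 1 := by
  have : Complex.I / (ħ : ℂ) * ((inner ℝ p (x - (1 / 2 : ℝ) • q) : ℝ) : ℂ) =
      ((inner ℝ p (x - (1 / 2 : ℝ) • q) / ħ : ℝ) : ℂ) * Complex.I := by
    push_cast; ring
  rw [hwPhase, this, Complex.norm_exp_ofReal_mul_I]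

theorem continuous_hwPhase {d : ℕ} (ħ : ℝ) (q p : Conf d) : Continuous (hwPhase ħ q p) := by
  unfold hwPhase
  fun_prop

theorem hwPhase_mul {d : ℕ} (ħ : ℝ) (q p x : Conf d) :
    hwPhase ħ q p x * hwPhase ħ (-q) (-p) (x - q) = 1 := by
  rw [hwPhase, hwPhase, ← Complex.exp_add, ← mul_add, ← Complex.ofReal_add]
  have : inner ℝ p (x - (1 / 2 : ℝ) • q) + inner ℝ (-p) (x - q - (1 / 2 : ℝ) • (-q)) =
      (0 : ℝ) := by
    simp only [inner_sub_right, inner_neg_left, inner_smul_right, inner_neg_right]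
    ring
  rw [this]
  simp

theorem memLp_hw {d : ℕ} (ħ : ℝ) (q p : Conf d) (f : L2 d) :
    MemLp (fun x => hwPhase ħ q p x * f (x - q)) 2 volume := by
  have h1 : MemLp (fun x => f (x - q)) 2 volume :=
    (Lp.memLp f).comp_measurePreserving (measurePreserving_sub_right volume q)
  refine h1.of_le ((continuous_hwPhase ħ q p).aestronglyMeasurable.mul h1.1) ?_
  exact Filter.Eventually.of_forall fun x => by simp [norm_hwPhase]

/-- The linear map underlying the Heisenberg–Weyl operator. -/
def hwLin {d : ℕ} (ħ : ℝ) (q p : Conf d) : L2 d →ₗ[ℂ] L2 d where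
  toFun f := (memLp_hw ħ q p f).toLp _
  map_add' f g := by
    rw [← MemLp.toLp_add, MemLp.toLp_eq_toLp_iff]
    filter_upwards [(measurePreserving_sub_right volume q).quasiMeasurePreserving.ae_eq_comp
      (Lp.coeFn_add f g)] with x hx
    simp only [Function.comp_apply, Pi.add_apply] at hx ⊢
    rw [hx, mul_add]
  map_smul' c f := by
    rw [RingHom.id_apply, ← MemLp.toLp_const_smul, MemLp.toLp_eq_toLp_iff]
    filter_upwards [(measurePreserving_sub_right volume q).quasiMeasurePreserving.ae_eq_comp
      (Lp.coeFn_smul c f)] with x hx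
    simp only [Function.comp_apply, Pi.smul_apply, smul_eq_mul] at hx ⊢
    rw [hx]
    ring

theorem hwLin_ae {d : ℕ} (ħ : ℝ) (q p : Conf d) (f : L2 d) :
    hwLin ħ q p f =ᵐ[volume] fun x => hwPhase ħ q p x * f (x - q) :=
  (memLp_hw ħ q p f).coeFn_toLp

theorem hwLin_hwLin {d : ℕ} (ħ : ℝ) (q p : Conf d) (f : L2 d) :
    hwLin ħ q p (hwLin ħ (-q) (-p) f) = f := by
  apply Lp.ext
  filter_upwards [hwLin_ae ħ q p (hwLin ħ (-q) (-p) f),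
    (measurePreserving_sub_right volume q).quasiMeasurePreserving.ae_eq_comp
      (hwLin_ae ħ (-q) (-p) f)] with x hx hx'
  simp only [Function.comp_apply] at hx'
  rw [hx, hx', ← mul_assoc, hwPhase_mul]
  simp

theorem norm_hwLin {d : ℕ} (ħ : ℝ) (q p : Conf d) (f : L2 d) : ‖hwLin ħ q p f‖ = ‖f‖ := by
  rw [Lp.norm_def, Lp.norm_def]
  congr 1
  rw [eLpNorm_congr_ae (hwLin_ae ħ q p f),
    ← eLpNorm_comp_measurePreserving (Lp.aestronglyMeasurable f)
      (measurePreserving_sub_right volume q)]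
  exact eLpNorm_congr_norm_ae (Filter.Eventually.of_forall fun x => by simp [norm_hwPhase])

/-- The Heisenberg–Weyl operator `(T_z f)(x) = e^{(i/ħ) p·(x - q/2)} f(x - q)`, `z = (q, p)`, as a
unitary operator on `L²(ℝ^d)`; see `hwLin_ae` for the formula. -/
def heisenbergWeyl {d : ℕ} (ħ : ℝ) (q p : Conf d) : L2 d ≃ₗᵢ[ℂ] L2 d where
  toLinearEquiv := LinearEquiv.ofLinearMap (hwLin ħ q p) (hwLin ħ (-q) (-p))
    (LinearMap.ext fun f => hwLin_hwLin ħ q p f)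
    (LinearMap.ext fun f => by simpa using hwLin_hwLin ħ (-q) (-p) f)
  norm_map' := norm_hwLin ħ q p

/-! ### The metaplectic group and its projection to the symplectic group -/

/-- `IsMetaplectic ħ U S` says that the unitary operator `U` on `L²(ℝ^d)` belongs to the
metaplectic group and that `S` is its image under the projection onto the symplectic group. The
metaplectic group is generated by the operators of the first three clauses, and the projection is
the homomorphism with the indicated values on these generators. -/
inductive IsMetaplectic {d : ℕ} (ħ : ℝ) :
    (L2 d ≃ₗᵢ[ℂ] L2 d) → Matrix (Phase d) (Phase d) ℝ → Prop
  /-- `Ĵψ(x) = (2πħi)^{-d/2} ∫ e^{-(i/ħ) x·y} ψ(y) dy` on Schwartz functions. -/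
  | fourier (U : L2 d ≃ₗᵢ[ℂ] L2 d)
      (hU : ∀ f : Sch d, U (f.toLp 2 volume) =ᵐ[volume] fun x =>
        ((2 * Real.pi * ħ * Complex.I : ℂ) ^ ((d : ℂ) / 2))⁻¹ *
          ∫ y, Complex.exp (-(Complex.I / (ħ : ℂ)) * ((inner ℝ x y : ℝ) : ℂ)) * f y) :
      IsMetaplectic ħ U (bigJ d ℝ)
  /-- `V̂_R ψ(x) = e^{(i/2ħ) xᵀ R x} ψ(x)` with `R` real symmetric. -/
  | chirp (U : L2 d ≃ₗᵢ[ℂ] L2 d) (R : Matrix (Fin d) (Fin d) ℝ) (hR : R.IsSymm)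
      (hU : ∀ f : L2 d, U f =ᵐ[volume] fun x =>
        Complex.exp (Complex.I / (2 * (ħ : ℂ)) * ((x.ofLp ⬝ᵥ R *ᵥ x.ofLp : ℝ) : ℂ)) * f x) :
      IsMetaplectic ħ U (Matrix.fromBlocks 1 0 R 1)
  /-- `M̂_L^m ψ(x) = i^m |det L|^{1/2} ψ(L x)` with `L` invertible and `m π ≡ arg (det L)` modulo
  `2π`, that is, `m` is even if `det L > 0` and odd if `det L < 0`. -/
  | dilation (U : L2 d ≃ₗᵢ[ℂ] L2 d) (L : Matrix (Fin d) (Fin d) ℝ) (hL : L.det ≠ 0)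
      (m : ℤ) (hm : Even m ↔ 0 < L.det)
      (hU : ∀ f : L2 d, U f =ᵐ[volume] fun x =>
        Complex.I ^ m * ((√|L.det| : ℝ) : ℂ) * f (WithLp.toLp 2 (L *ᵥ x.ofLp))) :
      IsMetaplectic ħ U (Matrix.fromBlocks L⁻¹ 0 0 Lᵀ)
  | mul (U₁ U₂ : L2 d ≃ₗᵢ[ℂ] L2 d) (S₁ S₂ : Matrix (Phase d) (Phase d) ℝ)
      (h₁ : IsMetaplectic ħ U₁ S₁) (h₂ : IsMetaplectic ħ U₂ S₂) :
      IsMetaplectic ħ (U₁ * U₂) (S₁ * S₂)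
  | inv (U : L2 d ≃ₗᵢ[ℂ] L2 d) (S : Matrix (Phase d) (Phase d) ℝ) (h : IsMetaplectic ħ U S) :
      IsMetaplectic ħ U⁻¹ S⁻¹

/-! ### Hagedorn wave packets -/

/-- The Gaussian `(πħ)^{-d/4} e^{-|x|²/(2ħ)}`. -/
def gaussian {d : ℕ} (ħ : ℝ) (x : Conf d) : ℂ :=
  (((Real.pi * ħ) ^ (-(d : ℝ) / 4) * Real.exp (-‖x‖ ^ 2 / (2 * ħ)) : ℝ) : ℂ)

theorem memLp_gaussian {d : ℕ} {ħ : ℝ} (hħ : 0 < ħ) :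
    MemLp (gaussian (d := d) ħ) 2 volume := by
  have hc : Continuous (gaussian (d := d) ħ) := by unfold gaussian; fun_prop
  rw [memLp_two_iff_integrable_sq_norm hc.aestronglyMeasurable]
  have h := GaussianFourier.integrable_cexp_neg_mul_sq_norm_add (V := Conf d)
    (b := ((1 / ħ : ℝ) : ℂ)) (by rw [Complex.ofReal_re]; positivity) 0 0
  have h2 := (h.norm).const_mul (((Real.pi * ħ) ^ (-(d : ℝ) / 4)) ^ 2)
  refine h2.congr (Filter.Eventually.of_forall fun x => ?_)
  simp only [gaussian, Complex.norm_real, norm_mul, mul_pow, Real.norm_eq_abs, sq_abs, Real.abs_exp,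
    Complex.norm_exp, ← Real.exp_nat_mul]
  congr 2
  have h3 : (-((1 / ħ : ℝ) : ℂ) * ((‖x‖ : ℝ) : ℂ) ^ 2 + 0 * ((inner ℝ (0 : Conf d) x : ℝ) : ℂ)) =
      ((-(1 / ħ) * ‖x‖ ^ 2 : ℝ) : ℂ) := by
    push_cast; ring
  rw [h3, Complex.ofReal_re]
  push_cast
  field_simp

/-- The ground state `ψ₀` of the harmonic oscillator as an element of `L²(ℝ^d)`. -/
def psiZero (d : ℕ) {ħ : ℝ} (hħ : 0 < ħ) : L2 d := (memLp_gaussian hħ).toLp _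

/-- `φ` is generated from the vector `φ₀` by the operators `R_1, …, R_d`: each `φ_n` lies in the
domain of each `R_j`, and `φ_{n + e_j} = (n_j + 1)^{-1/2} R_j φ_n`. -/
structure IsGeneratedBy {d : ℕ} (R : Fin d → L2 d →ₗ.[ℂ] L2 d) (φ₀ : L2 d)
    (φ : (Fin d → ℕ) → L2 d) : Prop where
  ground : φ 0 = φ₀
  raise : ∀ (n : Fin d → ℕ) (j : Fin d), ∃ h : φ n ∈ (R j).domain,
    φ (n + Pi.single j 1) = ((√((n j : ℝ) + 1) : ℝ) : ℂ)⁻¹ • R j ⟨φ n, h⟩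

/-- The raising operators `T_z Ŝ â*_j Ŝ* T_z*`, where `â* = ρ♯(W_ħ; ẑ)`. -/
def raisingConj {d : ℕ} (ħ : ℝ) (Shat : L2 d ≃ₗᵢ[ℂ] L2 d) (q p : Conf d) (j : Fin d) :
    L2 d →ₗ.[ℂ] L2 d :=
  conjugate (heisenbergWeyl ħ q p * Shat) (onL2 (rho (Wmat d ħ) (zHat ħ) (Sum.inr j)))

/-- The ground state `e^{-(i/2ħ) p·q} T_z Ŝ ψ₀`. -/
def groundConj {d : ℕ} {ħ : ℝ} (hħ : 0 < ħ) (Shat : L2 d ≃ₗᵢ[ℂ] L2 d) (q p : Conf d) : L2 d :=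
  Complex.exp (-(Complex.I / (2 * (ħ : ℂ))) * ((inner ℝ p q : ℝ) : ℂ)) •
    heisenbergWeyl ħ q p (Shat (psiZero d hħ))

/-- The raising operators `ρ♯_j(S W_ħ; ẑ - z) = i (2ħ)^{-1/2} [P*(x̂ - q) - Q*(p̂ - p)]_j`. -/
def raisingSymp {d : ℕ} (ħ : ℝ) (S : Matrix (Phase d) (Phase d) ℝ) (q p : Conf d) (j : Fin d) :
    L2 d →ₗ.[ℂ] L2 d :=
  onL2 (rho (S.map (fun r : ℝ => (r : ℂ)) * Wmat d ħ) (zHatShift ħ q p) (Sum.inr j))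

/-- The Gaussian `c (πħ)^{-d/4} exp((i/ħ) [(x-q)ᵀ P Q⁻¹ (x-q) / 2 + p·(x-q)])`; the prefactor `c`
is one of the two square roots of `(det Q)⁻¹`. -/
def groundGaussian {d : ℕ} (ħ : ℝ) (S : Matrix (Phase d) (Phase d) ℝ) (q p : Conf d) (c : ℂ)
    (x : Conf d) : ℂ :=
  c * (((Real.pi * ħ) ^ (-(d : ℝ) / 4) : ℝ) : ℂ) *
    Complex.exp (Complex.I / (ħ : ℂ) *
      ((1 / 2 : ℂ) * ((fun j => (((x - q) j : ℝ) : ℂ)) ⬝ᵥ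
          (Pmat S * (Qmat S)⁻¹) *ᵥ (fun j => (((x - q) j : ℝ) : ℂ))) +
        ((inner ℝ p (x - q) : ℝ) : ℂ)))

end Hagedorn

end

/-! The ladder operators are the components of `rho X zh` with `X = S W_ħ`. On Schwartz space
everything about them follows from two properties of `X`. Since `S` is symplectic, `iħ XᵀJX = J`
(`ladderMatrix_symplectic`), which is the canonical commutation relations in matrix form. Since `S`
is real, the two halves of the columns of `X` are complex conjugates, so lowering and raising
operators are formally adjoint (`inner_rho`). The Gaussian with matrix `PQ⁻¹` is Schwartz, has norm
one and is annihilated by every lowering operator; this rests on `QᵀP = PᵀQ` and `Q*P - P*Q = 2i`.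
The harmonic oscillator argument then gives orthonormality (`IsLadder.orthonormal`).

For completeness, `X` is invertible, so positions are affine combinations of ladder operators, and
the algebraic span of the family is closed under multiplication by coordinates. It therefore
contains every power of a linear form times the Gaussian `g`. If `f` is orthogonal to the span, all
moments of `f ḡ` vanish; Gaussian decay lets the exponential series be integrated termwise, so the
Fourier transform of `f ḡ` is zero, and `f = 0` because `g` has no zeros
(`orthogonal_map_incl_eq_bot`).

This settles the explicit description (b). In (a) the family is the image of the case `S = 1`, `z =
0` under the unitary `T_z Ŝ` and a phase. A metaplectic operator over `S` exists because a shear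
makes the upper left block invertible, after which `S` factors into images of the generators. -/

noncomputable section

namespace Hagedorn

/-! ### Abstract ladder operators -/

section Ladder

variable {ι V E : Type*} [DecidableEq ι] [AddCommGroup V] [Module ℂ V]

/-- The recursion `e (n + e_j) = (n_j + 1)^{-1/2} b_j e_n`. -/
def IsLadder (b : ι → Module.End ℂ V) (e : (ι → ℕ) → V) : Prop :=
  ∀ n j, e (n + Pi.single j 1) = ((√((n j : ℝ) + 1) : ℝ) : ℂ)⁻¹ • b j (e n)

variable {a b : ι → Module.End ℂ V} {e : (ι → ℕ) → V}

theorem IsLadder.raise (h : IsLadder b e) (n : ι → ℕ) (j : ι) :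
    b j (e n) = ((√((n j : ℝ) + 1) : ℝ) : ℂ) • e (n + Pi.single j 1) := by
  have h0 : ((√((n j : ℝ) + 1) : ℝ) : ℂ) ≠ 0 :=
    Complex.ofReal_ne_zero.mpr (Real.sqrt_pos.mpr (by positivity)).ne'
  rw [h n j, smul_smul, mul_inv_cancel₀ h0, one_smul]

theorem IsLadder.raise_mem_span (h : IsLadder b e) (j : ι) {f : V}
    (hf : f ∈ Submodule.span ℂ (Set.range e)) : b j f ∈ Submodule.span ℂ (Set.range e) := by
  have : Submodule.span ℂ (Set.range e) ≤ (Submodule.span ℂ (Set.range e)).comap (b j) := by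
    rw [Submodule.span_le]
    rintro _ ⟨n, rfl⟩
    rw [SetLike.mem_coe, Submodule.mem_comap, h.raise]
    exact Submodule.smul_mem _ _ (Submodule.subset_span ⟨_, rfl⟩)
  exact this hf

variable [Fintype ι]

/-- Induction on multi-indices by raising one entry at a time. -/
theorem multiIndex_induction {P : (ι → ℕ) → Prop} (zero : P 0)
    (add_single : ∀ n j, P n → P (n + Pi.single j 1)) (n : ι → ℕ) : P n := by
  induction hN : ∑ i, n i generalizing n with
  | zero =>
    have : n = 0 := by
      funext i
      exact Finset.sum_eq_zero_iff.mp hN i (Finset.mem_univ i)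
    rwa [this]
  | succ N ih =>
    obtain ⟨j, -, hj⟩ : ∃ j ∈ Finset.univ, n j ≠ 0 := by
      by_contra! h
      rw [Finset.sum_eq_zero h] at hN
      omega
    have hn : n = (n - Pi.single j 1) + Pi.single j 1 := by
      funext i
      by_cases hi : i = j
      · subst hi; simp; omega
      · simp [hi]
    rw [hn]
    refine add_single _ _ (ih _ ?_)
    have := congrArg (fun f : ι → ℕ => ∑ i, f i) hn
    simp only [Pi.add_apply, Finset.sum_add_distrib] at this
    have h1 : ∑ i, (Pi.single j 1 : ι → ℕ) i = 1 := by
      simp [Pi.single_apply]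
    omega

/-- The recursion prescribes `e n` once for each path from `0` to `n`. Commutativity makes the paths
agree, and `(n!)^{-1/2} bⁿ g` in multi-index notation is a solution. -/
theorem exists_isLadder (hb : ∀ i j, Commute (b i) (b j)) (g : V) :
    ∃ e : (ι → ℕ) → V, e 0 = g ∧ IsLadder b e := by
  -- The multi-index power `n ↦ ∏ b_jⁿʲ`, written as a monoid homomorphism so that adding `e_j`
  -- becomes multiplication by `b j`.
  let F : (ι → Multiplicative ℕ) →* Module.End ℂ V :=
    MonoidHom.noncommPiCoprod (fun j => powersHom _ (b j)) (fun i j _ x y =>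
      (hb i j).pow_pow x.toAdd y.toAdd)
  refine ⟨fun n => ((√(∏ j, ((n j).factorial : ℝ)) : ℝ) : ℂ)⁻¹ •
    F (fun j => Multiplicative.ofAdd (n j)) g, ?_, fun n j => ?_⟩
  · have : F (fun j => Multiplicative.ofAdd ((0 : ι → ℕ) j)) = 1 := map_one F
    simp only [this]
    simp
  · have h1 : (fun i => Multiplicative.ofAdd ((n + Pi.single j 1 : ι → ℕ) i)) =
        Pi.mulSingle j (Multiplicative.ofAdd 1) * fun i => Multiplicative.ofAdd (n i) := by
      funext i
      by_cases hi : i = j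
      · subst hi; simp [mul_comm]
      · simp [hi]
    have h2 : F (Pi.mulSingle j (Multiplicative.ofAdd 1)) = b j := by
      refine (MonoidHom.noncommPiCoprod_mulSingle _ _ _).trans ?_
      exact pow_one (b j)
    have h3 : (∏ i, (((n + Pi.single j 1 : ι → ℕ) i).factorial : ℝ)) =
        ((n j : ℝ) + 1) * ∏ i, ((n i).factorial : ℝ) := by
      rw [← Finset.mul_prod_erase _ _ (Finset.mem_univ j),
        ← Finset.mul_prod_erase (Finset.univ) (fun i => ((n i).factorial : ℝ))
          (Finset.mem_univ j), ← mul_assoc]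
      congr 1
      · simp [Nat.factorial_succ]
      · refine Finset.prod_congr rfl fun i hi => ?_
        simp [Finset.ne_of_mem_erase hi]
    simp only
    rw [h1, map_mul, h2, h3, Real.sqrt_mul (by positivity), map_smul, smul_smul]
    push_cast
    rw [mul_inv, Module.End.mul_apply]

/-- Commuting `a_j` past each raising operator leaves one extra term for each factor `b_j`. Where `n
j = 0` the subtraction is truncated, but the coefficient `√0` removes that term. -/
theorem IsLadder.lower (h : IsLadder b e)
    (hab : ∀ i j, a i * b j - b j * a i = if i = j then 1 else 0) (h0 : ∀ i, a i (e 0) = 0)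
    (n : ι → ℕ) (j : ι) : a j (e n) = ((√(n j : ℝ) : ℝ) : ℂ) • e (n - Pi.single j 1) := by
  induction n using multiIndex_induction with
  | zero => simp [h0]
  | add_single m k ih =>
    have hk : ((√((m k : ℝ) + 1) : ℝ) : ℂ) ≠ 0 :=
      Complex.ofReal_ne_zero.mpr (Real.sqrt_pos.mpr (by positivity)).ne'
    have h1 : a j (b k (e m)) = b k (a j (e m)) + (if j = k then (1 : Module.End ℂ V) else 0) (e m) := by
      rw [← hab j k]; simp
    rw [h m k, map_smul, h1, ih, map_smul]
    by_cases hjk : j = k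
    · subst hjk
      rw [if_pos rfl, Module.End.one_apply, h.raise]
      have h2 : m + Pi.single j 1 - Pi.single j 1 = m := by simp
      rw [h2]
      rcases Nat.eq_zero_or_pos (m j) with hm | hm
      · simp [hm]
      · have h3 : m - Pi.single j 1 + Pi.single j 1 = m := by
          funext i
          by_cases hi : i = j
          · subst hi; simp; omega
          · simp [hi]
        have h4 : (((m - Pi.single j 1 : ι → ℕ) j : ℕ) : ℝ) + 1 = m j := by
          simp [Nat.cast_sub hm]
        rw [h3, h4, smul_smul, ← Complex.ofReal_mul, Real.mul_self_sqrt (by positivity)]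
        have h5 : ((m j : ℝ) : ℂ) • e m + e m = (((m j : ℝ) : ℂ) + 1) • e m := by
          rw [add_smul, one_smul]
        rw [h5, smul_smul]
        congr 1
        rw [inv_mul_eq_iff_eq_mul₀ hk, Pi.add_apply, Pi.single_eq_same, Nat.cast_add, Nat.cast_one,
          ← Complex.ofReal_mul, Real.mul_self_sqrt (by positivity)]
        push_cast; rfl
    · rw [if_neg hjk, LinearMap.zero_apply, add_zero, h.raise]
      rcases Nat.eq_zero_or_pos (m j) with hm | hm
      · simp [hm, hjk]
      · have h3 : m - Pi.single j 1 + Pi.single k 1 = m + Pi.single k 1 - Pi.single j 1 := by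
          funext i
          by_cases hi : i = j
          · subst hi; simp [hjk]
          · simp [hi]
        rw [h3, smul_smul, smul_smul]
        congr 1
        have h4 : (m - Pi.single j 1 : ι → ℕ) k = m k := by simp [Ne.symm hjk]
        rw [h4, mul_right_comm, inv_mul_cancel₀ hk, one_mul]
        simp [hjk]

/-- Adjointness moves the last raising operator of the right vector to the left one, where it
lowers; this reduces the pair `(m, n + e_k)` to `(m - e_k, n)`. Only the algebra on `V` and the
inner product pulled back along `T` enter, so unbounded operators and their domains do not appear.
-/
theorem IsLadder.orthonormal [NormedAddCommGroup E] [InnerProductSpace ℂ E] (h : IsLadder b e)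
    (hab : ∀ i j, a i * b j - b j * a i = if i = j then 1 else 0) (h0 : ∀ i, a i (e 0) = 0)
    (T : V →ₗ[ℂ] E) (hT : ‖T (e 0)‖ = 1)
    (hadj : ∀ j f g, inner ℂ (T f) (T (b j g)) = inner ℂ (T (a j f)) (T g)) :
    Orthonormal ℂ (fun n => T (e n)) := by
  rw [orthonormal_iff_ite]
  intro m n
  induction n using multiIndex_induction generalizing m with
  | zero =>
    induction m using multiIndex_induction with
    | zero => simp [hT]
    | add_single m k _ =>
      have hne : m + Pi.single k 1 ≠ 0 := fun h => by simpa using congrFun h k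
      rw [if_neg hne, h m k, ← inner_conj_symm, map_smul, inner_smul_right, hadj, h0]
      simp
  | add_single n k ih =>
    have hk : ((√((n k : ℝ) + 1) : ℝ) : ℂ) ≠ 0 :=
      Complex.ofReal_ne_zero.mpr (Real.sqrt_pos.mpr (by positivity)).ne'
    -- The factors are `(n_k + 1)^{-1/2}` from raising and `√(m_k)` from lowering; they cancel
    -- exactly when `m = n + e_k`.
    rw [h n k, map_smul, inner_smul_right, hadj, h.lower hab h0, map_smul, inner_smul_left, ih]
    rcases Nat.eq_zero_or_pos (m k) with hm | hm
    · have hne : m ≠ n + Pi.single k 1 := fun h => by simpa [hm] using congrFun h k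
      rw [if_neg hne]
      simp [hm]
    · have h3 : m - Pi.single k 1 = n ↔ m = n + Pi.single k 1 := by
        constructor
        · rintro rfl
          funext i
          by_cases hi : i = k
          · subst hi; simp; omega
          · simp [hi]
        · rintro rfl; simp
      by_cases hmn : m = n + Pi.single k 1
      · rw [if_pos (h3.mpr hmn), if_pos hmn, mul_one, hmn, Complex.conj_ofReal]
        simp only [Pi.add_apply, Pi.single_eq_same, Nat.cast_add, Nat.cast_one]
        exact inv_mul_cancel₀ hk
      · rw [if_neg (mt h3.mp hmn), if_neg hmn]; simp

theorem IsLadder.lower_mem_span (h : IsLadder b e)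
    (hab : ∀ i j, a i * b j - b j * a i = if i = j then 1 else 0) (h0 : ∀ i, a i (e 0) = 0)
    (j : ι) {f : V} (hf : f ∈ Submodule.span ℂ (Set.range e)) :
    a j f ∈ Submodule.span ℂ (Set.range e) := by
  have : Submodule.span ℂ (Set.range e) ≤ (Submodule.span ℂ (Set.range e)).comap (a j) := by
    rw [Submodule.span_le]
    rintro _ ⟨n, rfl⟩
    rw [SetLike.mem_coe, Submodule.mem_comap, h.lower hab h0]
    exact Submodule.smul_mem _ _ (Submodule.subset_span ⟨_, rfl⟩)
  exact this hf

end Ladder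

variable {d : ℕ}

/-! ### Canonical commutation relations and symmetry on the Schwartz space -/

theorem inner_incl (f g : Sch d) :
    inner ℂ (incl d f) (incl d g) = ∫ x, g x * (starRingEnd ℂ) (f x) := by
  exact SchwartzMap.inner_toL2_toL2_eq f g volume

theorem inner_position (j : Fin d) (f g : Sch d) :
    inner ℂ (incl d f) (incl d (position j g)) = inner ℂ (incl d (position j f)) (incl d g) := by
  rw [inner_incl, inner_incl]
  congr 1
  funext x
  rw [position_apply, position_apply, map_mul, Complex.conj_ofReal]
  ring

/-- Integration by parts; the minus sign is absorbed by conjugating `-iħ`. The conjugate of `f` is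
itself made a Schwartz function `f'` for this. -/
theorem inner_momentum (ħ : ℝ) (j : Fin d) (f g : Sch d) :
    inner ℂ (incl d f) (incl d (momentum ħ j g)) = inner ℂ (incl d (momentum ħ j f)) (incl d g) := by
  let f' : Sch d := SchwartzMap.postcompCLM Complex.conjCLE.toContinuousLinearMap f
  have hf' : ∀ x, f' x = (starRingEnd ℂ) (f x) := fun x => rfl
  have hd : ∀ x v, fderiv ℝ f' x v = (starRingEnd ℂ) (fderiv ℝ f x v) := fun x v => by
    have h1 : (f' : Conf d → ℂ) = fun x => Complex.conjCLE (f x) := rfl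
    rw [h1]
    have h2 : HasFDerivAt (fun x => Complex.conjCLE (f x))
        (Complex.conjCLE.toContinuousLinearMap.comp (fderiv ℝ f x)) x :=
      Complex.conjCLE.toContinuousLinearMap.hasFDerivAt.comp x f.differentiableAt.hasFDerivAt
    rw [h2.fderiv]
    rfl
  have key := SchwartzMap.integral_mul_lineDerivOp_right_eq_neg_left (μ := volume) f' g
    (EuclideanSpace.single j (1 : ℝ))
  rw [inner_incl, inner_incl]
  have h3 : ∀ x, momentum ħ j g x * (starRingEnd ℂ) (f x) = -(Complex.I * (ħ : ℂ)) *
      (f' x * ∂_{EuclideanSpace.single j (1 : ℝ)} g x) := fun x => by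
    rw [momentum_apply, hf', SchwartzMap.lineDerivOp_apply_eq_fderiv]
    ring
  have h4 : ∀ x, g x * (starRingEnd ℂ) (momentum ħ j f x) = -(-(Complex.I * (ħ : ℂ)) *
      (∂_{EuclideanSpace.single j (1 : ℝ)} f' x * g x)) := fun x => by
    rw [momentum_apply, SchwartzMap.lineDerivOp_apply_eq_fderiv, hd]
    simp only [map_mul, map_neg, Complex.conj_I, Complex.conj_ofReal]
    ring
  simp_rw [h3, h4]
  rw [integral_neg, integral_const_mul, integral_const_mul, key]
  ring

theorem inner_zHat (ħ : ℝ) (k : Phase d) (f g : Sch d) :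
    inner ℂ (incl d f) (incl d (zHat ħ k g)) = inner ℂ (incl d (zHat ħ k f)) (incl d g) := by
  rcases k with j | j
  · exact inner_position j f g
  · exact inner_momentum ħ j f g

theorem inner_zHatShift (ħ : ℝ) (q p : Conf d) (k : Phase d) (f g : Sch d) :
    inner ℂ (incl d f) (incl d (zHatShift ħ q p k g)) =
      inner ℂ (incl d (zHatShift ħ q p k f)) (incl d g) := by
  simp only [zHatShift, LinearMap.sub_apply, LinearMap.smul_apply, Module.End.one_apply, map_sub,
    map_smul, inner_sub_right, inner_sub_left, inner_smul_left, inner_smul_right, inner_zHat,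
    Complex.conj_ofReal]

theorem position_commute (j k : Fin d) : position j * position k = position (d := d) k * position j := by
  ext f x
  simp only [Module.End.mul_apply, position_apply]
  ring

theorem lineDerivOp_comm (v w : Conf d) (f : Sch d) : ∂_{v} (∂_{w} f) = ∂_{w} (∂_{v} f) := by
  have key : ∀ (v w x : Conf d), ∂_{v} (∂_{w} f) x = fderiv ℝ (fderiv ℝ f) x v w := by
    intro v w x
    rw [SchwartzMap.lineDerivOp_apply_eq_fderiv]
    have h1 : ((∂_{w} f : Sch d) : Conf d → ℂ) = fun y => fderiv ℝ f y w :=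
      funext fun y => SchwartzMap.lineDerivOp_apply_eq_fderiv _ _ _
    have h2 : DifferentiableAt ℝ (fderiv ℝ f) x :=
      ((f.smooth 2).fderiv_right (m := 1) (by norm_num)).differentiable (by norm_num) x
    rw [h1, fderiv_clm_apply h2 (differentiableAt_const w)]
    simp
  ext x
  rw [key, key]
  exact ((f.smooth 2).contDiffAt.isSymmSndFDerivAt (by simp)) v w

theorem momentum_commute (ħ : ℝ) (j k : Fin d) :
    momentum ħ j * momentum ħ k = momentum (d := d) ħ k * momentum ħ j := by
  ext f x
  simp only [Module.End.mul_apply, momentum, LinearMap.smul_apply, map_smul]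
  congr 3
  exact lineDerivOp_comm _ _ f

theorem position_momentum (ħ : ℝ) (j k : Fin d) :
    position j * momentum ħ k - momentum (d := d) ħ k * position j =
      if j = k then (Complex.I * (ħ : ℂ)) • 1 else 0 := by
  ext f x
  have h1 : (position j f : Conf d → ℂ) = fun x => ((x j : ℝ) : ℂ) * f x :=
    funext fun x => position_apply j f x
  have h2 : HasFDerivAt (fun x : Conf d => ((x j : ℝ) : ℂ))
      (Complex.ofRealCLM ∘L (EuclideanSpace.proj (𝕜 := ℝ) j)) x :=
    (Complex.ofRealCLM ∘L (EuclideanSpace.proj (𝕜 := ℝ) j)).hasFDerivAt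
  have h3 : fderiv ℝ (fun x : Conf d => ((x j : ℝ) : ℂ) * f x) x = _ :=
    (h2.mul f.differentiableAt.hasFDerivAt).fderiv
  have h4 : (position j * momentum ħ k - momentum (d := d) ħ k * position j) f x =
      position j (momentum ħ k f) x - momentum ħ k (position j f) x := rfl
  rw [h4, position_apply, momentum_apply, momentum_apply, h1, h3]
  simp only [add_apply, smul_apply,
    ContinuousLinearMap.comp_apply, PiLp.proj_apply, PiLp.single_apply]
  by_cases hjk : j = k
  · simp [hjk]
    ring
  · simp [hjk]
    ring

theorem zHat_commutator (ħ : ℝ) (k l : Phase d) :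
    zHat ħ k * zHat ħ l - zHat ħ l * zHat ħ k =
      (Complex.I * (ħ : ℂ) * bigJ d ℂ k l) • (1 : Module.End ℂ (Sch d)) := by
  rcases k with j | j <;> rcases l with k | k
  · simp [zHat, bigJ, position_commute j k]
  · simp only [zHat, bigJ, Sum.elim_inl, Sum.elim_inr, position_momentum,
      Matrix.fromBlocks_apply₁₂, Matrix.one_apply]
    split_ifs <;> simp
  · simp only [zHat, bigJ, Sum.elim_inl, Sum.elim_inr,
      Matrix.fromBlocks_apply₂₁, Matrix.one_apply, Matrix.neg_apply]
    rw [← neg_sub, position_momentum]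
    by_cases hjk : j = k
    · simp [hjk]
    · simp [hjk, Ne.symm hjk]
  · simp [zHat, bigJ, momentum_commute ħ j k]

theorem zHatShift_commutator (ħ : ℝ) (q p : Conf d) (k l : Phase d) :
    zHatShift ħ q p k * zHatShift ħ q p l - zHatShift ħ q p l * zHatShift ħ q p k =
      (Complex.I * (ħ : ℂ) * bigJ d ℂ k l) • (1 : Module.End ℂ (Sch d)) := by
  rw [← zHat_commutator, zHatShift, zHatShift]
  simp only [sub_mul, mul_sub, smul_mul_assoc, mul_smul_comm, one_mul, mul_one]
  simp only [smul_sub]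
  rw [smul_comm (((Sum.elim q.ofLp p.ofLp k : ℝ) : ℂ))]
  abel

theorem bigJ_mul_bigJ {R : Type} [CommRing R] : bigJ d R * bigJ d R = -1 := by
  simp [bigJ, Matrix.fromBlocks_multiply, ← Matrix.fromBlocks_one, Matrix.fromBlocks_neg]

theorem bigJ_transpose {R : Type} [CommRing R] : (bigJ d R)ᵀ = -bigJ d R := by
  simp [bigJ, Matrix.fromBlocks_transpose, Matrix.fromBlocks_neg]

/-- The commutator is bilinear, so coefficients `Y = XᵀJ` produce `YJYᵀ`, and this equals `XᵀJX`
because `J² = -1` and `Jᵀ = -J`. -/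
theorem rho_commutator {ħ : ℝ} {zh : Phase d → Module.End ℂ (Sch d)}
    (hz : ∀ k l, zh k * zh l - zh l * zh k = (Complex.I * (ħ : ℂ) * bigJ d ℂ k l) • 1)
    (X : Matrix (Phase d) (Phase d) ℂ) (k l : Phase d) :
    rho X zh k * rho X zh l - rho X zh l * rho X zh k =
      (Complex.I * (ħ : ℂ) * (Xᵀ * bigJ d ℂ * X) k l) • 1 := by
  have h1 : Xᵀ * bigJ d ℂ * X = (Xᵀ * bigJ d ℂ) * bigJ d ℂ * (Xᵀ * bigJ d ℂ)ᵀ := by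
    rw [Matrix.transpose_mul, bigJ_transpose, Matrix.transpose_transpose,
      Matrix.mul_assoc Xᵀ (bigJ d ℂ) (bigJ d ℂ), bigJ_mul_bigJ]
    simp [Matrix.mul_assoc]
  rw [h1]
  have h2 : ∀ u v : Phase d → ℂ, (∑ m, u m • zh m) * (∑ n, v n • zh n) -
      (∑ n, v n • zh n) * (∑ m, u m • zh m) =
        ∑ m, ∑ n, (u m * v n) • (zh m * zh n - zh n * zh m) := fun u v => by
    rw [Finset.sum_mul_sum, Finset.sum_mul_sum, Finset.sum_comm (s := Finset.univ) (t := Finset.univ)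
      (f := fun n m => (v n • zh n) * (u m • zh m)), ← Finset.sum_sub_distrib]
    refine Finset.sum_congr rfl fun m _ => ?_
    rw [← Finset.sum_sub_distrib]
    refine Finset.sum_congr rfl fun n _ => ?_
    rw [smul_mul_smul_comm, smul_mul_smul_comm, mul_comm (v n), smul_sub]
  refine (h2 _ _).trans ?_
  generalize Xᵀ * bigJ d ℂ = Y
  simp_rw [hz, smul_smul, ← Finset.sum_smul]
  congr 1
  rw [Matrix.mul_apply, Finset.sum_comm, Finset.mul_sum]
  refine Finset.sum_congr rfl fun n _ => ?_
  rw [Matrix.mul_apply, Matrix.transpose_apply, Finset.sum_mul, Finset.mul_sum]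
  refine Finset.sum_congr rfl fun m _ => ?_
  ring

theorem bigJ_map_conj : (bigJ d ℂ).map (starRingEnd ℂ) = bigJ d ℂ := by
  rw [bigJ, Matrix.fromBlocks_map, Matrix.map_neg _ (map_neg _), Matrix.map_zero _ (map_zero _),
    Matrix.map_one _ (map_zero _) (map_one _)]

theorem inner_rho {zh : Phase d → Module.End ℂ (Sch d)}
    (hz : ∀ k f g, inner ℂ (incl d f) (incl d (zh k g)) = inner ℂ (incl d (zh k f)) (incl d g))
    {X : Matrix (Phase d) (Phase d) ℂ}
    (hX : ∀ l j, (starRingEnd ℂ) (X l (Sum.inl j)) = X l (Sum.inr j)) (j : Fin d) (f g : Sch d) :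
    inner ℂ (incl d f) (incl d (rho X zh (Sum.inr j) g)) =
      inner ℂ (incl d (rho X zh (Sum.inl j) f)) (incl d g) := by
  simp only [rho, LinearMap.sum_apply, LinearMap.smul_apply, map_sum, map_smul, sum_inner,
    inner_sum, inner_smul_left, inner_smul_right, hz]
  refine Finset.sum_congr rfl fun l _ => ?_
  congr 1
  rw [Matrix.mul_apply, Matrix.mul_apply, map_sum]
  refine Finset.sum_congr rfl fun m _ => ?_
  rw [map_mul, Matrix.transpose_apply, Matrix.transpose_apply, hX]
  congr 1
  conv_lhs => rw [← bigJ_map_conj]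
  rfl

/-- Recovers positions and momenta from the ladder operators; completeness needs this to obtain
coordinate multiplication. -/
theorem zh_eq_sum_rho (zh : Phase d → Module.End ℂ (Sch d)) {X M : Matrix (Phase d) (Phase d) ℂ}
    (hM : M * (Xᵀ * bigJ d ℂ) = 1) (k : Phase d) : zh k = ∑ l, M k l • rho X zh l := by
  simp only [rho, Finset.smul_sum, smul_smul]
  rw [Finset.sum_comm]
  simp_rw [← Finset.sum_smul, ← Matrix.mul_apply, hM]
  simp [Matrix.one_apply]

/-! ### Gaussians are Schwartz functions -/

theorem hasTemperateGrowth_fderiv {E F : Type*} [NormedAddCommGroup E] [NormedSpace ℝ E]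
    [NormedAddCommGroup F] [NormedSpace ℝ F] {f : E → F} (hf : f.HasTemperateGrowth) :
    (fderiv ℝ f).HasTemperateGrowth := by
  refine ⟨hf.1.fderiv_right (by simp), fun n => ?_⟩
  obtain ⟨k, C, h⟩ := hf.2 (n + 1)
  exact ⟨k, C, fun x => by rw [norm_iteratedFDeriv_fderiv]; exact h x⟩

/-- The derivative of `e^Φ g` is `e^Φ` times `g' + g Φ'`, again of temperate growth. This new
coefficient takes values in a space of linear maps, so the induction must range over all target
spaces `F`. -/
theorem norm_iteratedFDeriv_exp_smul_le {E : Type} [NormedAddCommGroup E] [NormedSpace ℝ E]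
    {Φ : E → ℂ} (hΦ : Φ.HasTemperateGrowth) (n : ℕ) :
    ∀ {F : Type} [NormedAddCommGroup F] [NormedSpace ℝ F] [NormedSpace ℂ F] [IsScalarTower ℝ ℂ F]
      {g : E → F}, g.HasTemperateGrowth → ∃ (k : ℕ) (C : ℝ), ∀ x,
        ‖iteratedFDeriv ℝ n (fun x => Complex.exp (Φ x) • g x) x‖ ≤
          C * (1 + ‖x‖) ^ k * ‖Complex.exp (Φ x)‖ := by
  induction n with
  | zero =>
    intro F _ _ _ _ g hg
    obtain ⟨k, C, h⟩ := hg.2 0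
    refine ⟨k, C, fun x => ?_⟩
    rw [norm_iteratedFDeriv_zero, norm_smul, mul_comm]
    have := h x
    rw [norm_iteratedFDeriv_zero] at this
    gcongr
  | succ n ih =>
    intro F _ _ _ _ g hg
    let L : F →L[ℝ] (ℂ →L[ℝ] F) := (ContinuousLinearMap.lsmul ℝ ℂ : ℂ →L[ℝ] F →L[ℝ] F).flip
    have h1 : (fun x => (L (g x)).comp (fderiv ℝ Φ x)).HasTemperateGrowth :=
      (ContinuousLinearMap.compL ℝ E ℂ F).bilinear_hasTemperateGrowth
        (L.hasTemperateGrowth.comp hg) (hasTemperateGrowth_fderiv hΦ)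
    obtain ⟨k, C, h⟩ := ih ((hasTemperateGrowth_fderiv hg).add h1)
    refine ⟨k, C, fun x => ?_⟩
    have h2 : fderiv ℝ (fun x => Complex.exp (Φ x) • g x) = fun x => Complex.exp (Φ x) •
        (fderiv ℝ g + fun x => (L (g x)).comp (fderiv ℝ Φ x)) x := by
      funext x
      have hΦx : HasFDerivAt Φ (fderiv ℝ Φ x) x :=
        (hΦ.1.differentiable (by simp) x).hasFDerivAt
      have hgx : HasFDerivAt g (fderiv ℝ g x) x :=
        (hg.1.differentiable (by simp) x).hasFDerivAt
      refine (hΦx.cexp.smul hgx).fderiv.trans ?_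
      ext v
      simp [L, smul_smul]
    rw [← norm_iteratedFDeriv_fderiv, h2]
    exact h x

theorem pow_mul_exp_neg_sq_le {δ : ℝ} (hδ : 0 < δ) (k : ℕ) :
    ∃ C : ℝ, ∀ r : ℝ, 0 ≤ r → (1 + r) ^ k * Real.exp (-δ * r ^ 2) ≤ C := by
  -- Completing the square gives `r - δr² ≤ 1/(4δ)`, and the exponential series gives `(1 + r)^k ≤
  -- k! e^{1 + r}`.
  refine ⟨k.factorial * Real.exp (1 + 1 / (4 * δ)), fun r hr => ?_⟩
  have h1 : -δ * r ^ 2 ≤ (1 + 1 / (4 * δ)) + -(1 + r) := by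
    have h : (1 + 1 / (4 * δ)) + -(1 + r) - -δ * r ^ 2 = (2 * δ * r - 1) ^ 2 / (4 * δ) := by
      field_simp
      ring
    have h' : 0 ≤ (2 * δ * r - 1) ^ 2 / (4 * δ) := by positivity
    linarith
  have h2 := Real.pow_div_factorial_le_exp (1 + r) (by positivity) k
  have h3 : (1 + r) ^ k ≤ k.factorial * Real.exp (1 + r) := by
    rwa [div_le_iff₀' (by positivity)] at h2
  calc (1 + r) ^ k * Real.exp (-δ * r ^ 2)
      ≤ (k.factorial * Real.exp (1 + r)) * Real.exp ((1 + 1 / (4 * δ)) + -(1 + r)) := by gcongr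
    _ = k.factorial * Real.exp (1 + 1 / (4 * δ)) := by
      rw [mul_assoc, ← Real.exp_add]
      congr 2
      ring

theorem neg_mul_norm_sub_sq_le {δ : ℝ} (hδ : 0 < δ) (q x : Conf d) :
    -δ * ‖x - q‖ ^ 2 ≤ δ * ‖q‖ ^ 2 + -(δ / 2) * ‖x‖ ^ 2 := by
  have h1 : ‖x‖ ≤ ‖x - q‖ + ‖q‖ := by
    simpa using norm_add_le (x - q) q
  have h2 : ‖x‖ ^ 2 ≤ (‖x - q‖ + ‖q‖) ^ 2 := by gcongr
  nlinarith [sq_nonneg (‖x - q‖ - ‖q‖)]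

/-- `c e^Φ` as a Schwartz function when `Φ` has temperate growth and its real part is bounded above
by `-δ |x - q|²`. -/
def schwartzExp (Φ : Conf d → ℂ) (hΦ : Φ.HasTemperateGrowth) (δ : ℝ) (hδ : 0 < δ) (q : Conf d)
    (hre : ∀ x, (Φ x).re ≤ -δ * ‖x - q‖ ^ 2) (c : ℂ) : Sch d where
  toFun x := Complex.exp (Φ x) • c
  smooth' := (Complex.contDiff_exp.comp hΦ.1).smul contDiff_const
  decay' k n := by
    obtain ⟨m, C, h⟩ := norm_iteratedFDeriv_exp_smul_le hΦ n (.const c)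
    obtain ⟨C', h'⟩ := pow_mul_exp_neg_sq_le (half_pos hδ) (k + m)
    refine ⟨|C| * Real.exp (δ * ‖q‖ ^ 2) * C', fun x => ?_⟩
    have h1 : ‖Complex.exp (Φ x)‖ ≤
        Real.exp (δ * ‖q‖ ^ 2) * Real.exp (-(δ / 2) * ‖x‖ ^ 2) := by
      rw [Complex.norm_exp, ← Real.exp_add, Real.exp_le_exp]
      exact (hre x).trans (neg_mul_norm_sub_sq_le hδ q x)
    calc ‖x‖ ^ k * ‖iteratedFDeriv ℝ n (fun x => Complex.exp (Φ x) • c) x‖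
        ≤ (1 + ‖x‖) ^ k * (|C| * (1 + ‖x‖) ^ m *
          (Real.exp (δ * ‖q‖ ^ 2) * Real.exp (-(δ / 2) * ‖x‖ ^ 2))) := by
          gcongr
          · linarith
          · refine (h x).trans ?_
            gcongr
            exact le_abs_self C
      _ = |C| * Real.exp (δ * ‖q‖ ^ 2) *
          ((1 + ‖x‖) ^ (k + m) * Real.exp (-(δ / 2) * ‖x‖ ^ 2)) := by ring
      _ ≤ |C| * Real.exp (δ * ‖q‖ ^ 2) * C' := by
          gcongr
          exact h' _ (norm_nonneg x)

theorem memLp_exp_norm_mul_exp {Φ : Conf d → ℂ} (hΦ : Continuous Φ) {δ : ℝ} (hδ : 0 < δ)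
    {q : Conf d} (hre : ∀ x, (Φ x).re ≤ -δ * ‖x - q‖ ^ 2) (c : ℂ) (t : ℝ) :
    MemLp (fun x => ((Real.exp (t * ‖x‖) : ℝ) : ℂ) * (Complex.exp (Φ x) • c)) 2 volume := by
  -- Recentring at the origin leaves decay rate `δ/2`. One half of it absorbs `t‖x‖ ≤ t²/δ +
  -- (δ/4)‖x‖²`; the other half is the rate of the standard Gaussian with parameter `2/δ` in place
  -- of `ħ`.
  have hδ' : 0 < 2 / δ := by positivity
  have h0 := (memLp_gaussian (d := d) hδ').const_mul
    (((((Real.pi * (2 / δ)) ^ (-(d : ℝ) / 4))⁻¹ * (Real.exp (t ^ 2 / δ + δ * ‖q‖ ^ 2)) * ‖c‖) : ℝ) : ℂ)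
  refine h0.of_le ?_ (Filter.Eventually.of_forall fun x => ?_)
  · exact Continuous.aestronglyMeasurable (by fun_prop)
  · have hpos : 0 < (Real.pi * (2 / δ)) ^ (-(d : ℝ) / 4) := by positivity
    rw [gaussian, ← Complex.ofReal_mul, Complex.norm_real, norm_mul, norm_smul, Complex.norm_real,
      Complex.norm_exp, Real.norm_of_nonneg (Real.exp_pos _).le, Real.norm_of_nonneg (by positivity)]
    have h2 : t * ‖x‖ + (Φ x).re ≤ t ^ 2 / δ + δ * ‖q‖ ^ 2 + -‖x‖ ^ 2 / (2 * (2 / δ)) := by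
      have h3 := (hre x).trans (neg_mul_norm_sub_sq_le hδ q x)
      have h4 : t ^ 2 / δ - t * ‖x‖ + (δ / 4) * ‖x‖ ^ 2 = (δ * ‖x‖ - 2 * t) ^ 2 / (4 * δ) := by
        field_simp
        ring
      have h5 : 0 ≤ (δ * ‖x‖ - 2 * t) ^ 2 / (4 * δ) := by positivity
      have h6 : -‖x‖ ^ 2 / (2 * (2 / δ)) = -(δ / 4) * ‖x‖ ^ 2 := by
        field_simp
        ring
      rw [h6]
      linarith
    calc Real.exp (t * ‖x‖) * (Real.exp (Φ x).re * ‖c‖)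
        = Real.exp (t * ‖x‖ + (Φ x).re) * ‖c‖ := by rw [Real.exp_add]; ring
      _ ≤ Real.exp (t ^ 2 / δ + δ * ‖q‖ ^ 2 + -‖x‖ ^ 2 / (2 * (2 / δ))) * ‖c‖ := by gcongr
      _ = _ := by
        rw [Real.exp_add]
        field_simp

/-! ### Completeness -/

open scoped FourierTransform ContDiff in
-- Every Schwartz function `ψ` is the Fourier transform of `𝓕⁻ψ`, so `∫ ψ h = ∫ (𝓕⁻ψ)(𝓕h) = 0`.
-- Testing against smooth compactly supported functions is enough.
theorem ae_eq_zero_of_fourier_eq_zero {h : Conf d → ℂ} (hint : Integrable h)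
    (h0 : ∀ w, 𝓕 h w = 0) : h =ᵐ[volume] 0 := by
  have key : ∀ ψ : Sch d, ∫ x, ψ x • h x = 0 := fun ψ => by
    have h2 := VectorFourier.integral_fourierIntegral_smul_eq_flip (L := innerₗ (Conf d))
      Real.continuous_fourierChar continuous_inner
      ((𝓕⁻ ψ : Sch d).integrable (μ := volume)) hint
    rw [flip_innerₗ] at h2
    change ∫ ξ, 𝓕 ((𝓕⁻ ψ : Sch d) : Conf d → ℂ) ξ • h ξ = ∫ x, (𝓕⁻ ψ : Sch d) x • 𝓕 h x at h2
    rw [← SchwartzMap.fourier_coe, FourierTransform.fourier_fourierInv_eq] at h2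
    rw [h2]
    simp [h0]
  have hz := ae_eq_zero_of_integral_contDiff_smul_eq_zero hint.locallyIntegrable
    fun g hg hg' => by
      have hgc : HasCompactSupport fun x => ((g x : ℝ) : ℂ) :=
        hg'.comp_left (g := Complex.ofReal) Complex.ofReal_zero
      have hgs : ContDiff ℝ ∞ fun x => ((g x : ℝ) : ℂ) := Complex.ofRealCLM.contDiff.comp hg
      exact (integral_congr_ae (Filter.Eventually.of_forall fun x =>
        (Complex.coe_smul (g x) (h x)).symm)).trans (key (hgc.toSchwartzMap hgs))
  exact hz

theorem exists_mem_inner_pow_mul {W : Submodule ℂ (Sch d)}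
    (hW : ∀ j, ∀ f ∈ W, position j f ∈ W) {g : Sch d} (hg : g ∈ W) (w : Conf d) (n : ℕ) :
    ∃ u ∈ W, ∀ x, u x = ((inner ℝ x w : ℝ) : ℂ) ^ n * g x := by
  induction n with
  | zero => exact ⟨g, hg, fun x => by simp⟩
  | succ n ih =>
    obtain ⟨u, hu, h⟩ := ih
    refine ⟨∑ j, ((w j : ℝ) : ℂ) • position j u,
      W.sum_mem fun j _ => W.smul_mem _ (hW j u hu), fun x => ?_⟩
    rw [sum_apply]
    simp_rw [smul_apply, position_apply, h, smul_eq_mul]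
    rw [pow_succ, PiLp.inner_apply]
    push_cast
    rw [mul_assoc, mul_left_comm, Finset.sum_mul]
    refine Finset.sum_congr rfl fun j _ => ?_
    simp
    ring

/-- The exponential is expanded and integrated termwise. For `‖z‖ ≤ 1` the terms are dominated by
those of the series of `e^{‖w‖‖x‖}‖h x‖`, which is integrable. -/
theorem integral_exp_inner_mul_eq_zero {h : Conf d → ℂ} (w : Conf d)
    (hint : Integrable fun x => Real.exp (‖w‖ * ‖x‖) * ‖h x‖)
    (hh : AEStronglyMeasurable h)
    (h0 : ∀ n : ℕ, ∫ x, ((inner ℝ x w : ℝ) : ℂ) ^ n * h x = 0) (z : ℂ) (hz : ‖z‖ ≤ 1) :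
    ∫ x, Complex.exp (z * ((inner ℝ x w : ℝ) : ℂ)) * h x = 0 := by
  have hs : ∀ r : ℝ, HasSum (fun n : ℕ => r ^ n / n.factorial) (Real.exp r) := fun r => by
    rw [Real.exp_eq_exp_ℝ]
    exact NormedSpace.expSeries_div_hasSum_exp r
  have hsc : ∀ r : ℂ, HasSum (fun n : ℕ => r ^ n / n.factorial) (Complex.exp r) := fun r => by
    rw [Complex.exp_eq_exp_ℂ]
    exact NormedSpace.expSeries_div_hasSum_exp r
  have hb : ∀ x, HasSum (fun n : ℕ => (‖w‖ * ‖x‖) ^ n / n.factorial * ‖h x‖)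
      (Real.exp (‖w‖ * ‖x‖) * ‖h x‖) := fun x => (hs _).mul_right _
  have key := hasSum_integral_of_dominated_convergence (μ := volume)
    (F := fun (n : ℕ) x => (z * ((inner ℝ x w : ℝ) : ℂ)) ^ n / n.factorial * h x)
    (f := fun x => Complex.exp (z * ((inner ℝ x w : ℝ) : ℂ)) * h x)
    (fun n x => (‖w‖ * ‖x‖) ^ n / n.factorial * ‖h x‖)
    (fun n => (Continuous.aestronglyMeasurable (by fun_prop)).mul hh)
    (fun n => Filter.Eventually.of_forall fun x => by
      rw [norm_mul, norm_div, norm_pow, norm_mul, Complex.norm_real, Complex.norm_natCast]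
      have h1 : ‖z‖ * ‖(inner ℝ x w : ℝ)‖ ≤ ‖w‖ * ‖x‖ := by
        calc ‖z‖ * ‖(inner ℝ x w : ℝ)‖ ≤ 1 * (‖x‖ * ‖w‖) := by
              gcongr
              exact norm_inner_le_norm x w
          _ = ‖w‖ * ‖x‖ := by ring
      gcongr)
    (Filter.Eventually.of_forall fun x => (hb x).summable)
    (hint.congr (Filter.Eventually.of_forall fun x => (hb x).tsum_eq.symm))
    (Filter.Eventually.of_forall fun x => (hsc _).mul_right _)
  have h1 : ∀ n : ℕ, ∫ x, (z * ((inner ℝ x w : ℝ) : ℂ)) ^ n / n.factorial * h x = 0 := fun n => by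
    have : ∀ x, (z * ((inner ℝ x w : ℝ) : ℂ)) ^ n / n.factorial * h x =
        z ^ n / n.factorial * (((inner ℝ x w : ℝ) : ℂ) ^ n * h x) := fun x => by ring
    simp_rw [this]
    rw [integral_const_mul, h0, mul_zero]
  simp_rw [h1] at key
  exact key.unique hasSum_zero

open scoped FourierTransform in
theorem orthogonal_map_incl_eq_bot {W : Submodule ℂ (Sch d)}
    (hW : ∀ j, ∀ f ∈ W, position j f ∈ W) {g : Sch d} (hg : g ∈ W) (hg0 : ∀ x, g x ≠ 0)
    (hexp : ∀ t : ℝ, MemLp (fun x => ((Real.exp (t * ‖x‖) : ℝ) : ℂ) * g x) 2 volume) :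
    (W.map (incl d))ᗮ = ⊥ := by
  rw [Submodule.eq_bot_iff]
  intro f hf
  have hf' : ∀ u ∈ W, ∫ x, f x * (starRingEnd ℂ) (u x) = 0 := fun u hu => by
    have h1 := (Submodule.mem_orthogonal _ _).mp hf _ (Submodule.mem_map_of_mem hu)
    rw [L2.inner_def] at h1
    rw [← h1]
    refine integral_congr_ae ?_
    filter_upwards [u.coeFn_toLp 2 volume] with x hx
    rw [incl_apply, hx]
    rfl
  let h : Conf d → ℂ := fun x => f x * (starRingEnd ℂ) (g x)
  have hmeas : AEStronglyMeasurable h :=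
    (Lp.aestronglyMeasurable f).mul
      (Continuous.aestronglyMeasurable (Complex.continuous_conj.comp g.continuous))
  have hint : ∀ t : ℝ, Integrable fun x => Real.exp (t * ‖x‖) * ‖h x‖ := fun t => by
    have h1 := ((hexp t).integrable_mul (Lp.memLp f)).norm
    refine h1.congr (Filter.Eventually.of_forall fun x => ?_)
    simp only [Pi.mul_apply, norm_mul, Complex.norm_real, h, RCLike.norm_conj,
      Real.norm_of_nonneg (Real.exp_pos _).le]
    ring
  have hint0 : Integrable h := by
    rw [← integrable_norm_iff hmeas]
    simpa using hint 0
  have h2 : ∀ (w : Conf d) (n : ℕ), ∫ x, ((inner ℝ x w : ℝ) : ℂ) ^ n * h x = 0 := fun w n => by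
    obtain ⟨u, hu, hux⟩ := exists_mem_inner_pow_mul hW hg w n
    rw [← hf' u hu]
    congr 1
    funext x
    rw [hux, map_mul, map_pow, Complex.conj_ofReal]
    simp only [h]
    ring
  have h3 : ∀ w, 𝓕 h w = 0 := fun w => by
    rw [Real.fourier_eq']
    -- The Fourier kernel is `e^{-2πi x·w}`, hence the vector `2πw` and the value `z = -i`.
    rw [← integral_exp_inner_mul_eq_zero ((2 * Real.pi) • w) (hint _) hmeas (h2 _) (-Complex.I)
      (by simp)]
    congr 1
    funext x
    rw [smul_eq_mul, inner_smul_right]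
    congr 2
    push_cast
    ring
  have h4 := ae_eq_zero_of_fourier_eq_zero hint0 h3
  rw [Lp.eq_zero_iff_ae_eq_zero]
  filter_upwards [h4] with x hx
  simpa [h, hg0 x] using hx

/-! ### Algebra of symplectic matrices -/

theorem bigJ_eq_neg_J (R : Type) [CommRing R] : bigJ d R = -Matrix.J (Fin d) R := by
  simp [bigJ, Matrix.J, Matrix.fromBlocks_neg]

theorem transpose_mul_bigJ_mul {S : Matrix (Phase d) (Phase d) ℝ}
    (hS : S ∈ Matrix.symplecticGroup (Fin d) ℝ) : Sᵀ * bigJ d ℝ * S = bigJ d ℝ := by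
  rw [bigJ_eq_neg_J, Matrix.mul_neg, Matrix.neg_mul, SymplecticGroup.mem_iff'.mp hS]

theorem bigJ_map : (bigJ d ℝ).map (fun r : ℝ => (r : ℂ)) = bigJ d ℂ := by
  rw [bigJ, Matrix.fromBlocks_map]
  simp only [bigJ]
  congr 1 <;> ext i j <;> simp [Matrix.one_apply] <;> split_ifs <;> simp

theorem map_ofReal_mul {m n o : Type*} [Fintype n] (A : Matrix m n ℝ) (B : Matrix n o ℝ) :
    (A * B).map (fun r : ℝ => (r : ℂ)) =
      A.map (fun r : ℝ => (r : ℂ)) * B.map (fun r : ℝ => (r : ℂ)) :=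
  Matrix.map_mul (f := Complex.ofRealHom)

/-- The matrix `S W_ħ`, whose columns are the coefficient vectors of the ladder operators. -/
def ladderMatrix (ħ : ℝ) (S : Matrix (Phase d) (Phase d) ℝ) : Matrix (Phase d) (Phase d) ℂ :=
  S.map (fun r : ℝ => (r : ℂ)) * Wmat d ħ

theorem ladderMatrix_eq (ħ : ℝ) (S : Matrix (Phase d) (Phase d) ℝ) :
    ladderMatrix ħ S = ((√(2 * ħ) : ℝ) : ℂ)⁻¹ • Matrix.fromBlocks (Complex.I • Qmat S)
      (-(Complex.I • (Qmat S).map (starRingEnd ℂ))) (Complex.I • Pmat S)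
      (-(Complex.I • (Pmat S).map (starRingEnd ℂ))) := by
  have h : S.map (fun r : ℝ => (r : ℂ)) = Matrix.fromBlocks
      (S.toBlocks₁₁.map (fun r : ℝ => (r : ℂ))) (S.toBlocks₁₂.map (fun r : ℝ => (r : ℂ)))
      (S.toBlocks₂₁.map (fun r : ℝ => (r : ℂ))) (S.toBlocks₂₂.map (fun r : ℝ => (r : ℂ))) := by
    rw [← Matrix.fromBlocks_map, Matrix.fromBlocks_toBlocks]
  have hI : ∀ z : ℂ, Complex.I * (Complex.I * z) = -z := fun z => by
    rw [← mul_assoc, Complex.I_mul_I, neg_one_mul]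
  rw [ladderMatrix, Wmat, Matrix.mul_smul, h, Matrix.fromBlocks_multiply]
  congr 2 <;> ext i j <;>
    simp [Qmat, Pmat, mul_add, hI] <;> ring

/-- This conjugation symmetry is what makes raising operators formal adjoints of lowering operators.
-/
theorem conj_ladderMatrix (ħ : ℝ) (S : Matrix (Phase d) (Phase d) ℝ) (l : Phase d) (j : Fin d) :
    (starRingEnd ℂ) (ladderMatrix ħ S l (Sum.inl j)) = ladderMatrix ħ S l (Sum.inr j) := by
  rw [ladderMatrix_eq]
  rcases l with l | l <;> simp

theorem I_mul_mul_inv_sqrt_mul {ħ : ℝ} (hħ : 0 < ħ) :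
    Complex.I * (ħ : ℂ) * ((√(2 * ħ) : ℝ) : ℂ)⁻¹ * ((√(2 * ħ) : ℝ) : ℂ)⁻¹ = Complex.I / 2 := by
  have hs : (((√(2 * ħ) : ℝ) : ℂ)⁻¹) * (((√(2 * ħ) : ℝ) : ℂ)⁻¹) = (2 * (ħ : ℂ))⁻¹ := by
    rw [← mul_inv, ← Complex.ofReal_mul, Real.mul_self_sqrt (by positivity)]
    push_cast; rfl
  have hħ' : (ħ : ℂ) ≠ 0 := by exact_mod_cast hħ.ne'
  rw [mul_assoc, hs]
  field_simp

/-- `SᵀJS = J` removes `S`, leaving the computation for `W_ħ` alone. Inserted in `rho_commutator`,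
the identity says that the ladder operators satisfy the canonical commutation relations. -/
theorem ladderMatrix_symplectic {ħ : ℝ} (hħ : 0 < ħ) {S : Matrix (Phase d) (Phase d) ℝ}
    (hS : S ∈ Matrix.symplecticGroup (Fin d) ℝ) :
    (Complex.I * (ħ : ℂ)) • ((ladderMatrix ħ S)ᵀ * bigJ d ℂ * ladderMatrix ħ S) = bigJ d ℂ := by
  have h1 : (ladderMatrix ħ S)ᵀ * bigJ d ℂ * ladderMatrix ħ S =
      (Wmat d ħ)ᵀ * bigJ d ℂ * Wmat d ħ := by
    have h2 := congrArg (fun M : Matrix _ _ ℝ => M.map (fun r : ℝ => (r : ℂ)))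
      (transpose_mul_bigJ_mul hS)
    simp only [map_ofReal_mul, bigJ_map, Matrix.transpose_map] at h2
    rw [ladderMatrix, Matrix.transpose_mul]
    conv_rhs => rw [← h2]
    simp only [Matrix.mul_assoc]
  rw [h1, Wmat, Matrix.transpose_smul, Matrix.smul_mul, Matrix.smul_mul, Matrix.mul_smul, smul_smul,
    smul_smul, I_mul_mul_inv_sqrt_mul hħ, bigJ, Matrix.fromBlocks_transpose, Matrix.fromBlocks_multiply,
    Matrix.fromBlocks_multiply, Matrix.fromBlocks_smul]
  congr 1 <;> ext i j <;>
    by_cases hij : i = j <;> simp [hij, Matrix.one_apply] <;> ring_nf <;> simp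

theorem ladderMatrix_left_inverse {ħ : ℝ} (hħ : 0 < ħ) {S : Matrix (Phase d) (Phase d) ℝ}
    (hS : S ∈ Matrix.symplecticGroup (Fin d) ℝ) :
    ((Complex.I * (ħ : ℂ)) • (ladderMatrix ħ S * -bigJ d ℂ)) *
      ((ladderMatrix ħ S)ᵀ * bigJ d ℂ) = 1 := by
  rw [mul_eq_one_comm, Matrix.mul_smul, ← Matrix.mul_assoc, ← Matrix.smul_mul,
    ladderMatrix_symplectic hħ hS, Matrix.mul_neg, bigJ_mul_bigJ, neg_neg]

/-- These are the `(1,1)` and `(2,1)` blocks of `ladderMatrix_symplectic`. They do not involve `ħ`,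
so later uses take `ħ = 1`. -/
theorem ladderMatrix_blocks {ħ : ℝ} (hħ : 0 < ħ) {S : Matrix (Phase d) (Phase d) ℝ}
    (hS : S ∈ Matrix.symplecticGroup (Fin d) ℝ) :
    (Qmat S)ᵀ * Pmat S = (Pmat S)ᵀ * Qmat S ∧
      (Qmat S)ᴴ * Pmat S - (Pmat S)ᴴ * Qmat S = (2 * Complex.I) • 1 := by
  have h := ladderMatrix_symplectic hħ hS
  rw [ladderMatrix_eq, Matrix.transpose_smul, Matrix.smul_mul, Matrix.smul_mul, Matrix.mul_smul,
    smul_smul, smul_smul, I_mul_mul_inv_sqrt_mul hħ, bigJ, Matrix.fromBlocks_transpose, Matrix.fromBlocks_multiply,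
    Matrix.fromBlocks_multiply, Matrix.fromBlocks_smul, Matrix.fromBlocks_inj] at h
  obtain ⟨h11, -, h21, -⟩ := h
  simp only [Matrix.transpose_smul, Matrix.transpose_neg, Matrix.mul_zero, Matrix.mul_one,
    Matrix.mul_neg, zero_add, add_zero, Matrix.smul_mul, Matrix.mul_smul, Matrix.neg_mul, neg_neg,
    smul_neg, smul_add, smul_smul, ← mul_assoc] at h11 h21
  have hκ : Complex.I / 2 * Complex.I * Complex.I = -(Complex.I / 2) := by
    rw [mul_assoc, Complex.I_mul_I, mul_neg_one]
  rw [hκ] at h11 h21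
  have hI : -(Complex.I / 2) ≠ 0 := by simp
  constructor
  · refine smul_right_injective _ hI ?_
    change -(Complex.I / 2) • _ = -(Complex.I / 2) • _
    rw [← sub_eq_zero, ← h11]
    abel
  · refine smul_right_injective _ hI ?_
    change -(Complex.I / 2) • _ = -(Complex.I / 2) • _
    have h4 : -(Complex.I / 2) * (2 * Complex.I) = 1 := by
      linear_combination -Complex.I_mul_I
    rw [smul_smul, h4, one_smul, ← neg_neg (1 : Matrix (Fin d) (Fin d) ℂ), ← h21, smul_sub]
    have hst : ∀ M : Matrix (Fin d) (Fin d) ℂ, Mᴴ = (M.map (starRingEnd ℂ))ᵀ := fun M => rfl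
    simp only [hst]
    module

open scoped ComplexOrder in
-- If `Qv = 0`, then `v*(Q*P - P*Q)v` vanishes, yet it equals `2i|v|²`.
theorem det_Qmat_ne_zero {S : Matrix (Phase d) (Phase d) ℝ}
    (hS : S ∈ Matrix.symplecticGroup (Fin d) ℝ) : (Qmat S).det ≠ 0 := by
  intro h
  obtain ⟨v, hv, hQv⟩ := Matrix.exists_mulVec_eq_zero_iff.mpr h
  have h2 := (ladderMatrix_blocks one_pos hS).2
  have h3 := congrArg (fun M => star v ⬝ᵥ M *ᵥ v) h2
  simp only [Matrix.sub_mulVec, ← Matrix.mulVec_mulVec, hQv, Matrix.mulVec_zero, sub_zero,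
    Matrix.smul_mulVec, Matrix.one_mulVec, dotProduct_smul] at h3
  rw [Matrix.dotProduct_mulVec, ← Matrix.star_mulVec, hQv, star_zero, zero_dotProduct] at h3
  have h4 : star v ⬝ᵥ v = 0 := by simpa using h3.symm
  exact hv (dotProduct_star_self_eq_zero.mp h4)

/-- The imaginary part of `QQ*` is `BAᵀ - ABᵀ`, which is zero because `Sᵀ` is symplectic too.
Reality of `QQ*` is what allows a real width matrix. -/
theorem Qmat_mul_conjTranspose {S : Matrix (Phase d) (Phase d) ℝ}
    (hS : S ∈ Matrix.symplecticGroup (Fin d) ℝ) :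
    Qmat S * (Qmat S)ᴴ = (S.toBlocks₁₁ * S.toBlocks₁₁ᵀ + S.toBlocks₁₂ * S.toBlocks₁₂ᵀ).map
      (fun r : ℝ => (r : ℂ)) := by
  have h1 := transpose_mul_bigJ_mul (SymplecticGroup.transpose_mem hS)
  rw [Matrix.transpose_transpose, ← Matrix.fromBlocks_toBlocks S, bigJ, Matrix.fromBlocks_transpose,
    Matrix.fromBlocks_multiply, Matrix.fromBlocks_multiply, Matrix.fromBlocks_inj] at h1
  have h2 := h1.1
  simp only [Matrix.mul_zero, Matrix.mul_one, Matrix.mul_neg, zero_add, add_zero, Matrix.neg_mul,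
    neg_add_eq_zero] at h2
  have h3 := congrArg (fun M : Matrix _ _ ℝ => M.map (fun r : ℝ => (r : ℂ))) h2
  simp only [map_ofReal_mul] at h3
  have h4 : ∀ M N : Matrix (Fin d) (Fin d) ℝ, (M + N).map (fun r : ℝ => (r : ℂ)) =
      M.map (fun r : ℝ => (r : ℂ)) + N.map (fun r : ℝ => (r : ℂ)) := fun M N =>
    Matrix.map_add _ (fun a b => Complex.ofReal_add a b) M N
  have h5 : ∀ M : Matrix (Fin d) (Fin d) ℝ,
      (M.map (fun r : ℝ => (r : ℂ)))ᴴ = Mᵀ.map (fun r : ℝ => (r : ℂ)) := fun M => by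
    ext i j
    simp
  rw [h4, map_ofReal_mul, map_ofReal_mul, Qmat, Matrix.conjTranspose_add,
    Matrix.conjTranspose_smul, h5, h5, Matrix.mul_add, Matrix.add_mul, Matrix.add_mul,
    Matrix.smul_mul, Matrix.smul_mul, Matrix.mul_smul, Matrix.mul_smul, h3, smul_smul]
  simp only [Complex.star_def, Complex.conj_I, mul_neg, Complex.I_mul_I, neg_neg, one_smul, neg_smul]
  abel

/-- The real matrix `B` with `BᵀB = (Q Q*)⁻¹`, which governs the width of the Gaussian. -/
theorem exists_width {S : Matrix (Phase d) (Phase d) ℝ}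
    (hS : S ∈ Matrix.symplecticGroup (Fin d) ℝ) : ∃ B : Matrix (Fin d) (Fin d) ℝ,
      |B.det| * ‖(Qmat S).det‖ = 1 ∧
      (Bᵀ * B).map (fun r : ℝ => (r : ℂ)) = (Qmat S)⁻¹ᴴ * (Qmat S)⁻¹ := by
  set G := S.toBlocks₁₁ * S.toBlocks₁₁ᵀ + S.toBlocks₁₂ * S.toBlocks₁₂ᵀ with hG
  have hQ := det_Qmat_ne_zero hS
  have hGQ := Qmat_mul_conjTranspose hS
  rw [← hG] at hGQ
  have hdet : G.det = ‖(Qmat S).det‖ ^ 2 := by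
    have h1 := congrArg Matrix.det hGQ
    rw [Matrix.det_mul, Matrix.det_conjTranspose, Complex.star_def, Complex.mul_conj,
      Complex.normSq_eq_norm_sq] at h1
    have h2 : (G.map (fun r : ℝ => (r : ℂ))).det = ((G.det : ℝ) : ℂ) :=
      (RingHom.map_det Complex.ofRealHom G).symm
    rw [h2] at h1
    exact_mod_cast h1.symm
  have hG0 : G.det ≠ 0 := by
    rw [hdet]
    exact pow_ne_zero 2 (norm_ne_zero_iff.mpr hQ)
  have hpos : G.PosSemidef := by
    have h1 := Matrix.posSemidef_self_mul_conjTranspose S.toBlocks₁₁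
    have h2 := Matrix.posSemidef_self_mul_conjTranspose S.toBlocks₁₂
    rw [Matrix.conjTranspose_eq_transpose_of_trivial] at h1 h2
    exact h1.add h2
  open scoped MatrixOrder Matrix.Norms.L2Operator in
  obtain ⟨B, hB⟩ := CStarAlgebra.nonneg_iff_eq_star_mul_self.mp hpos.inv.nonneg
  have hB' : G⁻¹ = Bᵀ * B := by
    rw [hB, Matrix.star_eq_conjTranspose, Matrix.conjTranspose_eq_transpose_of_trivial]
  refine ⟨B, ?_, ?_⟩
  · have h1 : |B.det| ^ 2 * ‖(Qmat S).det‖ ^ 2 = 1 := by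
      rw [sq_abs, ← hdet, sq]
      nth_rw 1 [← Matrix.det_transpose]
      rw [← Matrix.det_mul, ← hB', ← Matrix.det_mul,
        Matrix.nonsing_inv_mul _ (isUnit_iff_ne_zero.mpr hG0), Matrix.det_one]
    rw [← mul_pow] at h1
    exact (pow_eq_one_iff_of_nonneg (by positivity) two_ne_zero).mp h1
  · rw [← hB', Matrix.conjTranspose_nonsing_inv, ← Matrix.mul_inv_rev, hGQ]
    refine (Matrix.inv_eq_left_inv ?_).symm
    rw [← map_ofReal_mul, Matrix.nonsing_inv_mul _ (isUnit_iff_ne_zero.mpr hG0)]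
    exact Matrix.map_one _ Complex.ofReal_zero Complex.ofReal_one

/-- Multiplying `Q*P - P*Q = 2i` by the inverses of `Q*` and `Q` gives `N - N* = 2i(QQ*)⁻¹` for `N =
PQ⁻¹`. On a real vector, conjugating the form replaces `N` by `N*`. -/
theorem im_quadraticForm {S : Matrix (Phase d) (Phase d) ℝ}
    (hS : S ∈ Matrix.symplecticGroup (Fin d) ℝ) {B : Matrix (Fin d) (Fin d) ℝ}
    (hB : (Bᵀ * B).map (fun r : ℝ => (r : ℂ)) = (Qmat S)⁻¹ᴴ * (Qmat S)⁻¹) (y : Conf d) :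
    ((fun j => ((y j : ℝ) : ℂ)) ⬝ᵥ (Pmat S * (Qmat S)⁻¹) *ᵥ (fun j => ((y j : ℝ) : ℂ))).im =
      ‖Matrix.toLpLin 2 2 B y‖ ^ 2 := by
  have hQ := isUnit_iff_ne_zero.mpr (det_Qmat_ne_zero hS)
  set yc : Fin d → ℂ := fun j => ((y j : ℝ) : ℂ) with hyc
  set N := Pmat S * (Qmat S)⁻¹ with hN
  have hstar : star yc = yc := by
    funext j
    simp [hyc]
  have h1 : N - Nᴴ = (2 * Complex.I) • (Bᵀ * B).map (fun r : ℝ => (r : ℂ)) := by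
    have h2 : (Qmat S)ᴴ * N * Qmat S - (Qmat S)ᴴ * Nᴴ * Qmat S = (2 * Complex.I) • 1 := by
      rw [← (ladderMatrix_blocks one_pos hS).2, ← Matrix.conjTranspose_mul, hN, Matrix.mul_assoc,
        Matrix.mul_assoc, Matrix.nonsing_inv_mul _ hQ, Matrix.mul_one]
    rw [hB]
    calc N - Nᴴ = ((Qmat S)⁻¹ᴴ * (Qmat S)ᴴ) * (N - Nᴴ) * (Qmat S * (Qmat S)⁻¹) := by
          rw [← Matrix.conjTranspose_mul, Matrix.mul_nonsing_inv _ hQ,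
            Matrix.conjTranspose_one, Matrix.one_mul, Matrix.mul_one]
      _ = (Qmat S)⁻¹ᴴ * ((Qmat S)ᴴ * N * Qmat S - (Qmat S)ᴴ * Nᴴ * Qmat S) * (Qmat S)⁻¹ := by
          simp only [Matrix.mul_sub, Matrix.sub_mul, Matrix.mul_assoc]
      _ = _ := by
          rw [h2, Matrix.mul_smul, Matrix.smul_mul, Matrix.mul_one]
  have h3 : (starRingEnd ℂ) (yc ⬝ᵥ N *ᵥ yc) = yc ⬝ᵥ Nᴴ *ᵥ yc := by
    rw [← Complex.star_def]
    nth_rw 1 [← hstar]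
    rw [← Matrix.star_dotProduct, Matrix.star_mulVec, hstar, ← Matrix.dotProduct_mulVec]
  have h4 := congrArg (fun M => yc ⬝ᵥ M *ᵥ yc) h1
  simp only [Matrix.sub_mulVec, dotProduct_sub, Matrix.smul_mulVec, dotProduct_smul] at h4
  have h5 : yc ⬝ᵥ (Bᵀ * B).map (fun r : ℝ => (r : ℂ)) *ᵥ yc =
      ((y.ofLp ⬝ᵥ (Bᵀ * B) *ᵥ y.ofLp : ℝ) : ℂ) := by
    simp only [dotProduct, Matrix.mulVec, Matrix.map_apply, hyc]
    push_cast
    rfl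
  have h6 : ‖Matrix.toLpLin 2 2 B y‖ ^ 2 = y.ofLp ⬝ᵥ (Bᵀ * B) *ᵥ y.ofLp := by
    rw [← Matrix.mulVec_mulVec, Matrix.dotProduct_mulVec, Matrix.vecMul_transpose,
      EuclideanSpace.norm_sq_eq, Matrix.toLpLin_apply]
    simp [dotProduct, sq]
  rw [← h3, Complex.sub_conj, h5, smul_eq_mul] at h4
  have h7 := congrArg Complex.im h4
  simp at h7
  rw [h6]
  exact h7

/-! ### The Gaussian ground state -/

/-- The exponent of the Gaussian ground state. -/
def groundExponent (ħ : ℝ) (N : Matrix (Fin d) (Fin d) ℂ) (q p x : Conf d) : ℂ :=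
  Complex.I / (ħ : ℂ) *
    ((1 / 2 : ℂ) * ((fun j => (((x - q) j : ℝ) : ℂ)) ⬝ᵥ N *ᵥ (fun j => (((x - q) j : ℝ) : ℂ))) +
      ((inner ℝ p (x - q) : ℝ) : ℂ))

theorem groundGaussian_eq (ħ : ℝ) (S : Matrix (Phase d) (Phase d) ℝ) (q p : Conf d) (c : ℂ)
    (x : Conf d) : groundGaussian ħ S q p c x =
      Complex.exp (groundExponent ħ (Pmat S * (Qmat S)⁻¹) q p x) •
        (c * (((Real.pi * ħ) ^ (-(d : ℝ) / 4) : ℝ) : ℂ)) :=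
  mul_comm _ _

theorem hasTemperateGrowth_groundExponent (ħ : ℝ) (N : Matrix (Fin d) (Fin d) ℂ) (q p : Conf d) :
    (groundExponent ħ N q p).HasTemperateGrowth := by
  have hc : ∀ j, (fun x : Conf d => (((x - q) j : ℝ) : ℂ)).HasTemperateGrowth := fun j => by
    have h : (fun x : Conf d => (((x - q) j : ℝ) : ℂ)) =
        (fun x : Conf d => ((x j : ℝ) : ℂ)) - fun _ => ((q j : ℝ) : ℂ) := by
      funext x
      simp
    rw [h]
    exact (hasTemperateGrowth_coord j).sub (.const _)
  have h1 : groundExponent ħ N q p = fun x => (Complex.I / (ħ : ℂ)) *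
      ((1 / 2 : ℂ) * (∑ j, (((x - q) j : ℝ) : ℂ) * ∑ k, N j k * (((x - q) k : ℝ) : ℂ)) +
        ∑ j, ((p j : ℝ) : ℂ) * (((x - q) j : ℝ) : ℂ)) := by
    funext x
    rw [groundExponent, PiLp.inner_apply]
    simp only [dotProduct, Matrix.mulVec]
    push_cast
    congr 2
    refine Finset.sum_congr rfl fun j _ => ?_
    simp [mul_comm]
  rw [h1]
  refine .mul (.const _) (.add (.mul (.const _) (.sum fun j _ => .mul (hc j) (.sum fun k _ => ?_)))
    (.sum fun j _ => .mul (.const _) (hc j)))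
  exact .mul (.const _) (hc k)

theorem groundExponent_re {ħ : ℝ} {S : Matrix (Phase d) (Phase d) ℝ}
    (hS : S ∈ Matrix.symplecticGroup (Fin d) ℝ) {B : Matrix (Fin d) (Fin d) ℝ}
    (hB : (Bᵀ * B).map (fun r : ℝ => (r : ℂ)) = (Qmat S)⁻¹ᴴ * (Qmat S)⁻¹) (q p x : Conf d) :
    (groundExponent ħ (Pmat S * (Qmat S)⁻¹) q p x).re =
      -(1 / (2 * ħ)) * ‖Matrix.toLpLin 2 2 B (x - q)‖ ^ 2 := by
  rw [← im_quadraticForm hS hB, groundExponent]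
  generalize (fun j => (((x - q) j : ℝ) : ℂ)) ⬝ᵥ (Pmat S * (Qmat S)⁻¹) *ᵥ
    (fun j => (((x - q) j : ℝ) : ℂ)) = s
  have h : Complex.I / (ħ : ℂ) * ((1 / 2 : ℂ) * s + ((inner ℝ p (x - q) : ℝ) : ℂ)) =
      ((1 / (2 * ħ) : ℝ) : ℂ) * (Complex.I * s) +
        ((inner ℝ p (x - q) / ħ : ℝ) : ℂ) * Complex.I := by
    push_cast
    ring
  rw [h, Complex.add_re, Complex.re_ofReal_mul, Complex.re_ofReal_mul]
  simp

theorem exists_norm_le_toLpLin {B : Matrix (Fin d) (Fin d) ℝ} (hB : B.det ≠ 0) :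
    ∃ κ > 0, ∀ y : Conf d, κ * ‖y‖ ^ 2 ≤ ‖Matrix.toLpLin 2 2 B y‖ ^ 2 := by
  let T : Conf d →L[ℝ] Conf d := (Matrix.toLpLin 2 2 B⁻¹).toContinuousLinearMap
  have h1 : ∀ y, T (Matrix.toLpLin 2 2 B y) = y := fun y => by
    change Matrix.toLpLin 2 2 B⁻¹ (Matrix.toLpLin 2 2 B y) = y
    rw [Matrix.toLpLin_apply, Matrix.toLpLin_apply, Matrix.mulVec_mulVec,
      Matrix.nonsing_inv_mul _ (isUnit_iff_ne_zero.mpr hB), Matrix.one_mulVec]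
  -- The summand `1` keeps the constant positive when `d = 0`, where `‖T‖ = 0`.
  refine ⟨((‖T‖ + 1) ^ 2)⁻¹, by positivity, fun y => ?_⟩
  rw [inv_mul_le_iff₀ (by positivity), ← mul_pow]
  have h2 := T.le_opNorm (Matrix.toLpLin 2 2 B y)
  rw [h1] at h2
  have h3 : 0 ≤ ‖Matrix.toLpLin 2 2 B y‖ := norm_nonneg _
  gcongr
  linarith

theorem groundExponent_re_le {ħ : ℝ} (hħ : 0 < ħ) {S : Matrix (Phase d) (Phase d) ℝ}
    (hS : S ∈ Matrix.symplecticGroup (Fin d) ℝ) (q p : Conf d) : ∃ δ > 0, ∀ x,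
      (groundExponent ħ (Pmat S * (Qmat S)⁻¹) q p x).re ≤ -δ * ‖x - q‖ ^ 2 := by
  obtain ⟨B, hdet, hB⟩ := exists_width hS
  have hdet0 : B.det ≠ 0 := fun h => by simp [h] at hdet
  obtain ⟨κ, hκ, h⟩ := exists_norm_le_toLpLin hdet0
  refine ⟨1 / (2 * ħ) * κ, by positivity, fun x => ?_⟩
  rw [groundExponent_re hS hB, neg_mul, neg_mul, neg_le_neg_iff, mul_assoc]
  gcongr
  exact h _

theorem exists_schwartz_ground {ħ : ℝ} (hħ : 0 < ħ) {S : Matrix (Phase d) (Phase d) ℝ}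
    (hS : S ∈ Matrix.symplecticGroup (Fin d) ℝ) (q p : Conf d) (c : ℂ) :
    ∃ g : Sch d, (g : Conf d → ℂ) = groundGaussian ħ S q p c ∧
      ∀ t : ℝ, MemLp (fun x => ((Real.exp (t * ‖x‖) : ℝ) : ℂ) * g x) 2 volume := by
  obtain ⟨δ, hδ, h⟩ := groundExponent_re_le hħ hS q p
  have hΦ := hasTemperateGrowth_groundExponent ħ (Pmat S * (Qmat S)⁻¹) q p
  refine ⟨schwartzExp _ hΦ δ hδ q h (c * (((Real.pi * ħ) ^ (-(d : ℝ) / 4) : ℝ) : ℂ)),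
    funext fun x => (groundGaussian_eq ħ S q p c x).symm, fun t => ?_⟩
  exact memLp_exp_norm_mul_exp hΦ.1.continuous hδ h _ t

theorem map_toLpLin_volume {B : Matrix (Fin d) (Fin d) ℝ} (hB : B.det ≠ 0) :
    Measure.map (Matrix.toLpLin 2 2 B : Conf d →ₗ[ℝ] Conf d) volume =
      ENNReal.ofReal |B.det|⁻¹ • (volume : Measure (Conf d)) := by
  have h := Measure.map_linearMap_addHaar_eq_smul_addHaar (volume : Measure (Conf d))
    (f := Matrix.toLpLin 2 2 B) (by rwa [LinearMap.det_toLpLin])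
  rw [h, LinearMap.det_toLpLin, abs_inv]

theorem integral_comp_toLpLin {B : Matrix (Fin d) (Fin d) ℝ} (hB : B.det ≠ 0) {f : Conf d → ℝ}
    (hf : Continuous f) :
    ∫ x, f (Matrix.toLpLin 2 2 B x) = |B.det|⁻¹ * ∫ x, f x := by
  have hm : Measurable (Matrix.toLpLin 2 2 B : Conf d →ₗ[ℝ] Conf d) :=
    (LinearMap.continuous_of_finiteDimensional _).measurable
  rw [← integral_map hm.aemeasurable hf.aestronglyMeasurable, map_toLpLin_volume hB,
    integral_smul_measure, ENNReal.toReal_ofReal (by positivity), smul_eq_mul]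

/-- The substitution `y = B(x - q)` turns `|g|²` into a standard Gaussian with Jacobian `|det B|⁻¹ =
|det Q|`, which cancels `|c|² = |det Q|⁻¹`. Only `|c|` matters, so both square roots are admissible.
-/
theorem norm_incl_ground {ħ : ℝ} (hħ : 0 < ħ) {S : Matrix (Phase d) (Phase d) ℝ}
    (hS : S ∈ Matrix.symplecticGroup (Fin d) ℝ) (q p : Conf d) {c : ℂ}
    (hc : c ^ 2 = ((Qmat S).det)⁻¹) {g : Sch d}
    (hg : (g : Conf d → ℂ) = groundGaussian ħ S q p c) : ‖incl d g‖ = 1 := by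
  obtain ⟨B, hdet, hB⟩ := exists_width hS
  have hdet0 : B.det ≠ 0 := fun h => by simp [h] at hdet
  have hQ : ‖(Qmat S).det‖ ≠ 0 := norm_ne_zero_iff.mpr (det_Qmat_ne_zero hS)
  have h1 : ∀ x, g x * (starRingEnd ℂ) (g x) = ((‖c‖ ^ 2 * ((Real.pi * ħ) ^ (-(d : ℝ) / 4)) ^ 2 *
      Real.exp (-(1 / ħ) * ‖Matrix.toLpLin 2 2 B (x - q)‖ ^ 2) : ℝ) : ℂ) := fun x => by
    rw [Complex.mul_conj, Complex.normSq_eq_norm_sq, hg, groundGaussian_eq, norm_smul, norm_mul,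
      Complex.norm_exp, groundExponent_re hS hB, Complex.norm_real, Real.norm_eq_abs, mul_pow,
      mul_pow, sq_abs, ← Real.exp_nat_mul, mul_comm]
    congr 3
    push_cast
    field_simp
  have h2 : (∫ x : Conf d, Real.exp (-(1 / ħ) * ‖Matrix.toLpLin 2 2 B (x - q)‖ ^ 2)) =
      |B.det|⁻¹ * (Real.pi * ħ) ^ ((d : ℝ) / 2) := by
    rw [integral_sub_right_eq_self
      (fun x => Real.exp (-(1 / ħ) * ‖Matrix.toLpLin 2 2 B x‖ ^ 2)) q,
      integral_comp_toLpLin hdet0 (f := fun x => Real.exp (-(1 / ħ) * ‖x‖ ^ 2)) (by fun_prop),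
      GaussianFourier.integral_rexp_neg_mul_sq_norm (by positivity), finrank_euclideanSpace,
      Fintype.card_fin]
    congr 2
    field_simp
  have h3 : inner ℂ (incl d g) (incl d g) = 1 := by
    rw [inner_incl]
    simp_rw [h1]
    rw [integral_complex_ofReal, integral_const_mul, h2]
    have hn : ‖c‖ ^ 2 = ‖(Qmat S).det‖⁻¹ := by
      rw [← norm_pow, hc, norm_inv]
    have hd : |B.det|⁻¹ = ‖(Qmat S).det‖ := by
      rw [inv_eq_iff_eq_inv]
      exact eq_inv_of_mul_eq_one_left hdet
    have hp : ((Real.pi * ħ) ^ (-(d : ℝ) / 4)) ^ 2 * (Real.pi * ħ) ^ ((d : ℝ) / 2) = 1 := by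
      rw [← Real.rpow_natCast, ← Real.rpow_mul (by positivity), ← Real.rpow_add (by positivity)]
      ring_nf
      simp
    rw [hn, hd, mul_assoc, mul_left_comm (((Real.pi * ħ) ^ (-(d : ℝ) / 4)) ^ 2), hp, mul_one,
      inv_mul_cancel₀ hQ, Complex.ofReal_one]
  have h4 : ‖incl d g‖ ^ 2 = 1 := by
    rw [@norm_sq_eq_re_inner ℂ, h3]
    simp
  exact (pow_eq_one_iff_of_nonneg (norm_nonneg _) two_ne_zero).mp h4

theorem isSymm_Pmat_mul_inv {S : Matrix (Phase d) (Phase d) ℝ}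
    (hS : S ∈ Matrix.symplecticGroup (Fin d) ℝ) : (Pmat S * (Qmat S)⁻¹).IsSymm := by
  have hQ := isUnit_iff_ne_zero.mpr (det_Qmat_ne_zero hS)
  have hQt : IsUnit (Qmat S)ᵀ.det := by rwa [Matrix.det_transpose]
  rw [Matrix.IsSymm, Matrix.transpose_mul, Matrix.transpose_nonsing_inv]
  calc ((Qmat S)ᵀ)⁻¹ * (Pmat S)ᵀ
      = ((Qmat S)ᵀ)⁻¹ * ((Pmat S)ᵀ * Qmat S) * (Qmat S)⁻¹ := by
        rw [Matrix.mul_assoc, Matrix.mul_assoc, Matrix.mul_nonsing_inv _ hQ, Matrix.mul_one]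
    _ = Pmat S * (Qmat S)⁻¹ := by
        rw [← (ladderMatrix_blocks one_pos hS).1, ← Matrix.mul_assoc,
          Matrix.nonsing_inv_mul _ hQt, Matrix.one_mul]

/-- Along a coordinate line the exponent is a quadratic polynomial in `t`; symmetry of `N` merges
its two cross terms. -/
theorem fderiv_groundExponent (ħ : ℝ) {N : Matrix (Fin d) (Fin d) ℂ} (hN : N.IsSymm)
    (q p x : Conf d) (l : Fin d) :
    fderiv ℝ (groundExponent ħ N q p) x (EuclideanSpace.single l 1) = Complex.I / (ħ : ℂ) *
      ((N *ᵥ fun j => (((x - q) j : ℝ) : ℂ)) l + ((p l : ℝ) : ℂ)) := by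
  have hd : DifferentiableAt ℝ (groundExponent ħ N q p) x :=
    (hasTemperateGrowth_groundExponent ħ N q p).1.differentiable (by simp) x
  rw [← hd.lineDeriv_eq_fderiv, lineDeriv]
  set yc : Fin d → ℂ := fun j => (((x - q) j : ℝ) : ℂ) with hyc
  have h1 : (fun t : ℝ => groundExponent ħ N q p (x + t • EuclideanSpace.single l 1)) =
      fun t : ℝ => Complex.I / (ħ : ℂ) * ((1 / 2 : ℂ) * (yc ⬝ᵥ N *ᵥ yc + (t : ℂ) *
        (2 * (N *ᵥ yc) l) + (t : ℂ) ^ 2 * N l l) + (((inner ℝ p (x - q) : ℝ) : ℂ) +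
          (t : ℂ) * ((p l : ℝ) : ℂ))) := by
    funext t
    have h2 : (fun j => (((x + t • EuclideanSpace.single l (1 : ℝ) - q : Conf d) j : ℝ) : ℂ)) =
        yc + (t : ℂ) • Pi.single l 1 := by
      funext j
      by_cases hj : j = l
      · subst hj
        simp [hyc]
        ring
      · simp [hyc, hj]
    have h3 : (inner ℝ p (x + t • EuclideanSpace.single l (1 : ℝ) - q) : ℝ) =
        inner ℝ p (x - q) + t * p l := by
      rw [add_sub_right_comm, inner_add_right, inner_smul_right,
        EuclideanSpace.inner_single_right]
      simp
    have h4 : yc ⬝ᵥ N *ᵥ Pi.single l 1 = (N *ᵥ yc) l := by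
      rw [Matrix.dotProduct_mulVec, dotProduct_single_one, ← Matrix.mulVec_transpose, hN]
    rw [groundExponent, h2, h3]
    congr 2
    · simp only [Matrix.mulVec_add, add_dotProduct, dotProduct_add, Matrix.mulVec_smul,
        smul_dotProduct, dotProduct_smul, single_dotProduct, h4, smul_eq_mul]
      simp
      ring
    · push_cast
      rfl
  rw [h1]
  have h5 : HasDerivAt (fun t : ℝ => (t : ℂ)) 1 0 := Complex.ofRealCLM.hasDerivAt
  have h6 := (((((h5.mul_const (2 * (N *ᵥ yc) l)).const_add (yc ⬝ᵥ N *ᵥ yc)).add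
    ((h5.pow 2).mul_const (N l l))).const_mul (1 / 2 : ℂ)).add
      ((h5.mul_const ((p l : ℝ) : ℂ)).const_add ((inner ℝ p (x - q) : ℝ) : ℂ))).const_mul
        (Complex.I / (ħ : ℂ))
  refine h6.deriv.trans ?_
  simp

theorem zHatShift_inl_apply (ħ : ℝ) (q p : Conf d) (l : Fin d) (g : Sch d) (x : Conf d) :
    zHatShift ħ q p (Sum.inl l) g x = (((x - q) l : ℝ) : ℂ) * g x := by
  have : zHatShift ħ q p (Sum.inl l) g x = position l g x - ((q l : ℝ) : ℂ) * g x := rfl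
  rw [this, position_apply]
  simp [sub_mul]

theorem zHatShift_inr_ground {ħ : ℝ} (hħ : 0 < ħ) {N : Matrix (Fin d) (Fin d) ℂ} (hN : N.IsSymm)
    (q p : Conf d) (l : Fin d) {g : Sch d} {c : ℂ}
    (hg : ∀ x, g x = Complex.exp (groundExponent ħ N q p x) • c) (x : Conf d) :
    zHatShift ħ q p (Sum.inr l) g x = (N *ᵥ fun j => (((x - q) j : ℝ) : ℂ)) l * g x := by
  have h1 : zHatShift ħ q p (Sum.inr l) g x = momentum ħ l g x - ((p l : ℝ) : ℂ) * g x := rfl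
  have hd : HasFDerivAt (groundExponent ħ N q p) (fderiv ℝ (groundExponent ħ N q p) x) x :=
    ((hasTemperateGrowth_groundExponent ħ N q p).1.differentiable (by simp) x).hasFDerivAt
  have h2 : (g : Conf d → ℂ) = fun x => Complex.exp (groundExponent ħ N q p x) * c := funext hg
  have hħ' : (ħ : ℂ) ≠ 0 := by exact_mod_cast hħ.ne'
  rw [h1, momentum_apply, h2, (hd.cexp.mul_const c).fderiv]
  simp only [smul_apply, fderiv_groundExponent ħ hN, smul_eq_mul]
  field_simp
  ring_nf
  simp

/-- On the Gaussian, `p̂ - p` acts as multiplication by `PQ⁻¹(x - q)`. The lowering operators are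
proportional to `Qᵀ(p̂ - p) - Pᵀ(x̂ - q)`, and `QᵀPQ⁻¹ = Pᵀ`. -/
theorem lower_ground {ħ : ℝ} (hħ : 0 < ħ) {S : Matrix (Phase d) (Phase d) ℝ}
    (hS : S ∈ Matrix.symplecticGroup (Fin d) ℝ) (q p : Conf d) (c : ℂ) {g : Sch d}
    (hg : (g : Conf d → ℂ) = groundGaussian ħ S q p c) (j : Fin d) :
    rho (ladderMatrix ħ S) (zHatShift ħ q p) (Sum.inl j) g = 0 := by
  have hQ := isUnit_iff_ne_zero.mpr (det_Qmat_ne_zero hS)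
  ext x
  set yc : Fin d → ℂ := fun j => (((x - q) j : ℝ) : ℂ) with hyc
  have h1 : rho (ladderMatrix ħ S) (zHatShift ħ q p) (Sum.inl j) g x =
      ∑ l, ((ladderMatrix ħ S)ᵀ * bigJ d ℂ) (Sum.inl j) l * zHatShift ħ q p l g x := by
    rw [rho, LinearMap.sum_apply, sum_apply]
    rfl
  have h2 : (ladderMatrix ħ S)ᵀ * bigJ d ℂ = ((√(2 * ħ) : ℝ) : ℂ)⁻¹ • Matrix.fromBlocks
      (-(Complex.I • (Pmat S)ᵀ)) (Complex.I • (Qmat S)ᵀ)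
      (Complex.I • (Pmat S)ᴴ) (-(Complex.I • (Qmat S)ᴴ)) := by
    rw [ladderMatrix_eq, Matrix.transpose_smul, Matrix.smul_mul, bigJ,
      Matrix.fromBlocks_transpose, Matrix.fromBlocks_multiply]
    congr 2 <;> ext i k <;> simp
  have h3 := zHatShift_inr_ground hħ (isSymm_Pmat_mul_inv hS) q p
    (g := g) (hg := fun x => (congrFun hg x).trans (groundGaussian_eq ħ S q p c x))
  have h4 : (Pmat S)ᵀ *ᵥ yc = (Qmat S)ᵀ *ᵥ ((Pmat S * (Qmat S)⁻¹) *ᵥ yc) := by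
    rw [Matrix.mulVec_mulVec, ← Matrix.mul_assoc, (ladderMatrix_blocks one_pos hS).1,
      Matrix.mul_assoc, Matrix.mul_nonsing_inv _ hQ, Matrix.mul_one]
  rw [h1, h2, Fintype.sum_sum_type]
  simp only [zHatShift_inl_apply, h3, Matrix.smul_apply, Matrix.fromBlocks_apply₁₁,
    Matrix.fromBlocks_apply₁₂, Matrix.neg_apply, smul_eq_mul]
  generalize (Pmat S * (Qmat S)⁻¹) *ᵥ yc = v at h4
  have h5 := congrFun h4 j
  simp only [Matrix.mulVec, dotProduct] at h5
  have h6 : ∀ (M : Matrix (Fin d) (Fin d) ℂ) (a : ℂ) (u : Fin d → ℂ),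
      ∑ l, ((√(2 * ħ) : ℝ) : ℂ)⁻¹ * (a * M j l) * (u l * g x) =
        ((√(2 * ħ) : ℝ) : ℂ)⁻¹ * a * g x * ∑ l, M j l * u l := fun M a u => by
    rw [Finset.mul_sum]
    exact Finset.sum_congr rfl fun l _ => by ring
  simp only [← neg_mul]
  change ∑ l, _ * (yc l * g x) + _ = (0 : ℂ)
  rw [h6, h6, h5]
  ring

/-! ### The Hagedorn family -/

theorem position_mem_of_rho_mem {ħ : ℝ} (hħ : 0 < ħ) {S : Matrix (Phase d) (Phase d) ℝ}
    (hS : S ∈ Matrix.symplecticGroup (Fin d) ℝ) (q p : Conf d) {W : Submodule ℂ (Sch d)}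
    (hW : ∀ k, ∀ f ∈ W, rho (ladderMatrix ħ S) (zHatShift ħ q p) k f ∈ W) (j : Fin d) {f : Sch d}
    (hf : f ∈ W) : position j f ∈ W := by
  have h1 : position j f = zHatShift ħ q p (Sum.inl j) f + ((q j : ℝ) : ℂ) • f := by
    change position j f = position j f - ((q j : ℝ) : ℂ) • f + ((q j : ℝ) : ℂ) • f
    rw [sub_add_cancel]
  rw [h1, zh_eq_sum_rho (zHatShift ħ q p) (ladderMatrix_left_inverse hħ hS), LinearMap.sum_apply]
  exact W.add_mem (W.sum_mem fun k _ => W.smul_mem _ (hW k f hf)) (W.smul_mem _ hf)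

theorem exists_hagedorn_family {ħ : ℝ} (hħ : 0 < ħ) {S : Matrix (Phase d) (Phase d) ℝ}
    (hS : S ∈ Matrix.symplecticGroup (Fin d) ℝ) (q p : Conf d) {c : ℂ}
    (hc : c ^ 2 = ((Qmat S).det)⁻¹) :
    ∃ e : (Fin d → ℕ) → Sch d, (e 0 : Conf d → ℂ) = groundGaussian ħ S q p c ∧
      IsLadder (fun j => rho (ladderMatrix ħ S) (zHatShift ħ q p) (Sum.inr j)) e ∧
      ∃ b : HilbertBasis (Fin d → ℕ) ℂ (L2 d), ∀ n, b n = incl d (e n) := by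
  obtain ⟨g, hg, hexp⟩ := exists_schwartz_ground hħ hS q p c
  have hcomm : ∀ k l, rho (ladderMatrix ħ S) (zHatShift ħ q p) k *
      rho (ladderMatrix ħ S) (zHatShift ħ q p) l - rho (ladderMatrix ħ S) (zHatShift ħ q p) l *
        rho (ladderMatrix ħ S) (zHatShift ħ q p) k = bigJ d ℂ k l • 1 := fun k l => by
    rw [rho_commutator (zHatShift_commutator ħ q p)]
    congr 1
    exact congrFun (congrFun (ladderMatrix_symplectic hħ hS) k) l
  have hraise : ∀ i j, Commute (rho (ladderMatrix ħ S) (zHatShift ħ q p) (Sum.inr i))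
      (rho (ladderMatrix ħ S) (zHatShift ħ q p) (Sum.inr j)) := fun i j => by
    rw [Commute, SemiconjBy, ← sub_eq_zero, hcomm]
    simp [bigJ]
  have hccr : ∀ i j, rho (ladderMatrix ħ S) (zHatShift ħ q p) (Sum.inl i) *
      rho (ladderMatrix ħ S) (zHatShift ħ q p) (Sum.inr j) -
        rho (ladderMatrix ħ S) (zHatShift ħ q p) (Sum.inr j) *
          rho (ladderMatrix ħ S) (zHatShift ħ q p) (Sum.inl i) = if i = j then 1 else 0 :=
    fun i j => by
      rw [hcomm, bigJ, Matrix.fromBlocks_apply₁₂, Matrix.one_apply]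
      split_ifs <;> simp
  obtain ⟨e, he0, he⟩ := exists_isLadder hraise g
  have hg' : (e 0 : Conf d → ℂ) = groundGaussian ħ S q p c := by rw [he0, hg]
  have hlow : ∀ i, rho (ladderMatrix ħ S) (zHatShift ħ q p) (Sum.inl i) (e 0) = 0 :=
    lower_ground hħ hS q p c hg'
  have hortho : Orthonormal ℂ fun n => incl d (e n) :=
    he.orthonormal hccr hlow (incl d) (norm_incl_ground hħ hS q p hc hg')
      (inner_rho (inner_zHatShift ħ q p) (conj_ladderMatrix ħ S))
  have hspan : (Submodule.span ℂ (Set.range fun n => incl d (e n)))ᗮ = ⊥ := by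
    have h1 : Set.range (fun n => incl d (e n)) = incl d '' Set.range e :=
      Set.range_comp (incl d) e
    rw [h1, ← Submodule.map_span]
    refine orthogonal_map_incl_eq_bot (g := g) (fun j f hf => position_mem_of_rho_mem hħ hS q p
      (fun k f hf => ?_) j hf) (he0 ▸ Submodule.subset_span ⟨0, rfl⟩) (fun x => ?_) hexp
    · rcases k with k | k
      · exact he.lower_mem_span hccr hlow k hf
      · exact he.raise_mem_span k hf
    · have hc0 : c ≠ 0 := by
        rintro rfl
        exact inv_ne_zero (det_Qmat_ne_zero hS) (by rw [← hc]; simp)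
      have hp : (Real.pi * ħ) ^ (-(d : ℝ) / 4) ≠ 0 := by positivity
      rw [hg, groundGaussian_eq]
      exact smul_ne_zero (Complex.exp_ne_zero _)
        (mul_ne_zero hc0 (Complex.ofReal_ne_zero.mpr hp))
  exact ⟨e, hg', he, HilbertBasis.mkOfOrthogonalEqBot hortho hspan,
    fun n => congrFun (HilbertBasis.coe_mkOfOrthogonalEqBot hortho hspan) n⟩

/-! ### Uniqueness of the generated family and transport by unitary operators -/

theorem IsGeneratedBy.unique {R : Fin d → L2 d →ₗ.[ℂ] L2 d} {φ₀ : L2 d}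
    {φ φ' : (Fin d → ℕ) → L2 d} (h : IsGeneratedBy R φ₀ φ) (h' : IsGeneratedBy R φ₀ φ') :
    φ' = φ := by
  funext n
  induction n using multiIndex_induction with
  | zero => rw [h.ground, h'.ground]
  | add_single n j ih =>
    obtain ⟨h1, h2⟩ := h.raise n j
    obtain ⟨h1', h2'⟩ := h'.raise n j
    rw [h2, h2']
    congr 2
    exact Subtype.ext ih

theorem isGeneratedBy_incl {A : Fin d → Module.End ℂ (Sch d)} {e : (Fin d → ℕ) → Sch d}
    (he : IsLadder A e) : IsGeneratedBy (fun j => onL2 (A j)) (incl d (e 0)) (fun n => incl d (e n))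
    where
  ground := rfl
  raise n j := ⟨LinearMap.mem_range_self _ _, by
    rw [onL2_incl, ← map_smul]
    exact congrArg (incl d) (he n j)⟩

theorem IsGeneratedBy.conjugate {R : Fin d → L2 d →ₗ.[ℂ] L2 d} {φ₀ : L2 d}
    {φ : (Fin d → ℕ) → L2 d} (h : IsGeneratedBy R φ₀ φ) (V : L2 d ≃ₗᵢ[ℂ] L2 d) (z : ℂ) :
    IsGeneratedBy (fun j => Hagedorn.conjugate V (R j)) (z • V φ₀) (fun n => z • V (φ n)) where
  ground := by rw [h.ground]
  raise n j := by
    obtain ⟨h1, h2⟩ := h.raise n j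
    have h3 : V.symm (z • V (φ n)) = z • φ n := by simp
    have h4 : V.symm (z • V (φ n)) ∈ (R j).domain := by
      rw [h3]
      exact (R j).domain.smul_mem z h1
    refine ⟨h4, ?_⟩
    have h5 : (⟨V.symm (z • V (φ n)), h4⟩ : (R j).domain) = z • ⟨φ n, h1⟩ := Subtype.ext h3
    rw [conjugate_apply V (R j) _ h4, h5, LinearPMap.map_smul, map_smul, h2, map_smul, smul_comm]

/-- The image of a Hilbert basis under a unitary operator and a phase factor. -/
theorem exists_hilbertBasis_smul_map {ι : Type*} (b : HilbertBasis ι ℂ (L2 d))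
    (V : L2 d ≃ₗᵢ[ℂ] L2 d) {z : ℂ} (hz : ‖z‖ = 1) :
    ∃ b' : HilbertBasis ι ℂ (L2 d), (b' : ι → L2 d) = fun n => z • V (b n) := by
  have hz0 : z ≠ 0 := fun h => by simp [h] at hz
  let Z : L2 d ≃ₗᵢ[ℂ] L2 d :=
    { toLinearEquiv := LinearEquiv.smulOfNeZero ℂ (L2 d) z hz0
      norm_map' := fun f => by
        change ‖z • f‖ = ‖f‖
        rw [norm_smul, hz, one_mul] }
  refine ⟨HilbertBasis.ofRepr ((V.trans Z).symm.trans b.repr), funext fun n => ?_⟩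
  classical
  rw [← HilbertBasis.repr_symm_single]
  have h : b n = b.repr.symm (lp.single 2 n 1) := (b.repr_symm_single n).symm
  rw [h]
  rfl

/-! ### The harmonic oscillator case `S = 1`, `z = 0` and the two descriptions -/

theorem Qmat_one : Qmat (1 : Matrix (Phase d) (Phase d) ℝ) = 1 := by
  ext i j
  by_cases hij : i = j <;>
    simp [Qmat, Matrix.toBlocks₁₁, Matrix.toBlocks₁₂, Matrix.one_apply, hij]

theorem Pmat_one : Pmat (1 : Matrix (Phase d) (Phase d) ℝ) = Complex.I • 1 := by
  ext i j
  by_cases hij : i = j <;>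
    simp [Pmat, Matrix.toBlocks₂₁, Matrix.toBlocks₂₂, Matrix.one_apply, hij]

theorem groundGaussian_one (ħ : ℝ) :
    groundGaussian ħ (1 : Matrix (Phase d) (Phase d) ℝ) 0 0 1 = gaussian ħ := by
  funext x
  rw [groundGaussian, gaussian, Qmat_one, Pmat_one, one_mul, inv_one, Matrix.mul_one,
    Matrix.smul_mulVec, Matrix.one_mulVec, Complex.ofReal_mul, Complex.ofReal_exp]
  congr 2
  have h : (fun j => (((x - 0 : Conf d) j : ℝ) : ℂ)) ⬝ᵥ (fun j => (((x - 0 : Conf d) j : ℝ) : ℂ)) =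
      ((‖x‖ ^ 2 : ℝ) : ℂ) := by
    rw [EuclideanSpace.norm_sq_eq]
    simp [dotProduct, sq]
  rw [dotProduct_smul, h]
  simp only [inner_zero_left, Complex.ofReal_zero, add_zero, smul_eq_mul]
  push_cast
  linear_combination ((‖x‖ : ℂ) ^ 2 / (2 * (ħ : ℂ))) * Complex.I_mul_I

theorem ladderMatrix_one (ħ : ℝ) : ladderMatrix ħ (1 : Matrix (Phase d) (Phase d) ℝ) = Wmat d ħ := by
  have h : (1 : Matrix (Phase d) (Phase d) ℝ).map (fun r : ℝ => (r : ℂ)) = 1 :=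
    Matrix.map_one _ Complex.ofReal_zero Complex.ofReal_one
  rw [ladderMatrix, h, Matrix.one_mul]

theorem zHatShift_zero (ħ : ℝ) : zHatShift (d := d) ħ 0 0 = zHat ħ := by
  funext k
  rcases k with k | k <;> simp [zHatShift]

/-- For `S = 1` and `z = 0` the ladder construction yields the Hermite basis generated from `ψ₀` by
`â*`. Conjugation by `T_z Ŝ` carries it over, and the scalar phase commutes with the linear
recursion. -/
theorem exists_basis_conj {ħ : ℝ} (hħ : 0 < ħ) (Shat : L2 d ≃ₗᵢ[ℂ] L2 d) (q p : Conf d) :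
    ∃ φ : HilbertBasis (Fin d → ℕ) ℂ (L2 d),
      IsGeneratedBy (raisingConj ħ Shat q p) (groundConj hħ Shat q p) φ := by
  obtain ⟨e, he0, he, b, hb⟩ := exists_hagedorn_family hħ (S := 1) (Submonoid.one_mem _) 0 0
    (c := 1) (by simp [Qmat_one])
  rw [groundGaussian_one] at he0
  rw [ladderMatrix_one, zHatShift_zero] at he
  have hz : ‖Complex.exp (-(Complex.I / (2 * (ħ : ℂ))) * ((inner ℝ p q : ℝ) : ℂ))‖ = 1 := by
    have : -(Complex.I / (2 * (ħ : ℂ))) * ((inner ℝ p q : ℝ) : ℂ) =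
        ((-(inner ℝ p q / (2 * ħ)) : ℝ) : ℂ) * Complex.I := by
      push_cast
      ring
    rw [this, Complex.norm_exp_ofReal_mul_I]
  obtain ⟨φ, hφ⟩ := exists_hilbertBasis_smul_map b (heisenbergWeyl ħ q p * Shat) hz
  have h0 : incl d (e 0) = psiZero d hħ := by
    refine Lp.ext ?_
    filter_upwards [(e 0).coeFn_toLp 2 volume, (memLp_gaussian (d := d) hħ).coeFn_toLp] with x h1 h2
    rw [incl_apply, h1, psiZero, h2, he0]
  have h1 := (isGeneratedBy_incl he).conjugate (heisenbergWeyl ħ q p * Shat)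
    (Complex.exp (-(Complex.I / (2 * (ħ : ℂ))) * ((inner ℝ p q : ℝ) : ℂ)))
  rw [h0] at h1
  refine ⟨φ, ?_⟩
  rw [hφ]
  simp_rw [hb]
  exact h1

theorem exists_basis_symp {ħ : ℝ} (hħ : 0 < ħ) {S : Matrix (Phase d) (Phase d) ℝ}
    (hS : S ∈ Matrix.symplecticGroup (Fin d) ℝ) (q p : Conf d) {c : ℂ}
    (hc : c ^ 2 = ((Qmat S).det)⁻¹) :
    ∃ hc : MemLp (groundGaussian ħ S q p c) 2 volume,
      ∃ φ : HilbertBasis (Fin d → ℕ) ℂ (L2 d),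
        IsGeneratedBy (raisingSymp ħ S q p) (hc.toLp _) φ := by
  obtain ⟨e, he0, he, b, hb⟩ := exists_hagedorn_family hħ hS q p hc
  have hmem : MemLp (groundGaussian ħ S q p c) 2 volume := he0 ▸ (e 0).memLp 2 volume
  refine ⟨hmem, b, ?_⟩
  have h0 : incl d (e 0) = hmem.toLp _ := by
    refine Lp.ext ?_
    filter_upwards [(e 0).coeFn_toLp 2 volume, hmem.coeFn_toLp] with x h1 h2
    rw [incl_apply, h1, h2, he0]
  rw [← h0, funext hb]
  exact isGeneratedBy_incl he

/-! ### Existence of metaplectic operators -/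

/-- The isometry `f ↦ w · (f ∘ τ)` of `L²`. -/
def weightedComp (w : Conf d → ℂ) (τ : Conf d → Conf d)
    (hτ : Measure.QuasiMeasurePreserving τ volume volume)
    (hmem : ∀ f : L2 d, MemLp (fun x => w x * f (τ x)) 2 volume)
    (hnorm : ∀ f : L2 d, eLpNorm (fun x => w x * f (τ x)) 2 volume = eLpNorm f 2 volume) :
    L2 d →ₗᵢ[ℂ] L2 d where
  toFun f := (hmem f).toLp _
  map_add' f g := by
    rw [← MemLp.toLp_add, MemLp.toLp_eq_toLp_iff]
    filter_upwards [hτ.ae_eq_comp (Lp.coeFn_add f g)] with x hx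
    simp only [Function.comp_apply, Pi.add_apply] at hx ⊢
    rw [hx, mul_add]
  map_smul' c f := by
    rw [RingHom.id_apply, ← MemLp.toLp_const_smul, MemLp.toLp_eq_toLp_iff]
    filter_upwards [hτ.ae_eq_comp (Lp.coeFn_smul c f)] with x hx
    simp only [Function.comp_apply, Pi.smul_apply, smul_eq_mul] at hx ⊢
    rw [hx]
    ring
  norm_map' f := by
    change ‖(hmem f).toLp _‖ = ‖f‖
    rw [Lp.norm_toLp, hnorm, Lp.norm_def]

theorem weightedComp_ae (w : Conf d → ℂ) (τ : Conf d → Conf d)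
    (hτ : Measure.QuasiMeasurePreserving τ volume volume)
    (hmem : ∀ f : L2 d, MemLp (fun x => w x * f (τ x)) 2 volume)
    (hnorm : ∀ f : L2 d, eLpNorm (fun x => w x * f (τ x)) 2 volume = eLpNorm f 2 volume)
    (f : L2 d) : weightedComp w τ hτ hmem hnorm f =ᵐ[volume] fun x => w x * f (τ x) :=
  (hmem f).coeFn_toLp

theorem exists_mul_unimodular {w : Conf d → ℂ} (hw : Continuous w) (hw1 : ∀ x, ‖w x‖ = 1) :
    ∃ U : L2 d ≃ₗᵢ[ℂ] L2 d, ∀ f : L2 d, U f =ᵐ[volume] fun x => w x * f x := by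
  have hn : ∀ u : Conf d → ℂ, (∀ x, ‖u x‖ = 1) → ∀ f : L2 d,
      eLpNorm (fun x => u x * f x) 2 volume = eLpNorm f 2 volume := fun u hu f =>
    eLpNorm_congr_norm_ae (Filter.Eventually.of_forall fun x => by simp [hu])
  have hm : ∀ u : Conf d → ℂ, Continuous u → (∀ x, ‖u x‖ = 1) → ∀ f : L2 d,
      MemLp (fun x => u x * f x) 2 volume := fun u hu hu1 f =>
    ⟨hu.aestronglyMeasurable.mul (Lp.aestronglyMeasurable f), by
      rw [hn u hu1]; exact (Lp.memLp f).2⟩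
  have hτ := Measure.QuasiMeasurePreserving.id (volume : Measure (Conf d))
  have hw' : Continuous fun x => (w x)⁻¹ := hw.inv₀ fun x => by simp [← norm_ne_zero_iff, hw1]
  have hw1' : ∀ x, ‖(w x)⁻¹‖ = 1 := fun x => by simp [hw1]
  let T := weightedComp w id hτ (hm w hw hw1) (hn w hw1)
  let T' := weightedComp (fun x => (w x)⁻¹) id hτ (hm _ hw' hw1') (hn _ hw1')
  have hT : Function.Surjective T := fun f => ⟨T' f, by
    refine Lp.ext ?_
    filter_upwards [weightedComp_ae w id hτ (hm w hw hw1) (hn w hw1) (T' f),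
      weightedComp_ae _ id hτ (hm _ hw' hw1') (hn _ hw1') f] with x h1 h2
    rw [h1, id, h2, id, ← mul_assoc, mul_inv_cancel₀ (by simp [← norm_ne_zero_iff, hw1]), one_mul]⟩
  exact ⟨LinearIsometryEquiv.ofSurjective T hT,
    weightedComp_ae w id hτ (hm w hw hw1) (hn w hw1)⟩

theorem quasiMeasurePreserving_toLpLin {L : Matrix (Fin d) (Fin d) ℝ} (hL : L.det ≠ 0) :
    Measure.QuasiMeasurePreserving (Matrix.toLpLin 2 2 L : Conf d →ₗ[ℝ] Conf d) volume volume := by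
  refine ⟨(LinearMap.continuous_of_finiteDimensional _).measurable, ?_⟩
  rw [map_toLpLin_volume hL]
  exact Measure.smul_absolutelyContinuous

theorem eLpNorm_dilation {L : Matrix (Fin d) (Fin d) ℝ} (hL : L.det ≠ 0) {z : ℂ}
    (hz : ‖z‖ = √|L.det|) (f : L2 d) :
    eLpNorm (fun x => z * f (Matrix.toLpLin 2 2 L x)) 2 volume = eLpNorm f 2 volume := by
  have hpos : 0 < |L.det| := abs_pos.mpr hL
  have hf : AEStronglyMeasurable f (Measure.map (Matrix.toLpLin 2 2 L : Conf d →ₗ[ℝ] Conf d)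
      volume) := by
    rw [map_toLpLin_volume hL]
    exact (Lp.aestronglyMeasurable f).smul_measure _
  have h1 : eLpNorm (f ∘ (Matrix.toLpLin 2 2 L : Conf d →ₗ[ℝ] Conf d)) 2 volume =
      ENNReal.ofReal (√|L.det|)⁻¹ * eLpNorm f 2 volume := by
    rw [← eLpNorm_map_measure hf (quasiMeasurePreserving_toLpLin hL).aemeasurable,
      map_toLpLin_volume hL, eLpNorm_smul_measure_of_ne_top (by norm_num), smul_eq_mul]
    congr 1
    rw [ENNReal.ofReal_rpow_of_pos (by positivity), Real.sqrt_eq_rpow, ← Real.inv_rpow hpos.le]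
    norm_num
  have h2 : (fun x => z * f (Matrix.toLpLin 2 2 L x)) =
      z • (f ∘ (Matrix.toLpLin 2 2 L : Conf d →ₗ[ℝ] Conf d)) := rfl
  have h3 : 0 < √|L.det| := Real.sqrt_pos.mpr hpos
  rw [h2, eLpNorm_const_smul, h1, ← mul_assoc, ← ofReal_norm, hz,
    ← ENNReal.ofReal_mul h3.le, mul_inv_cancel₀ h3.ne', ENNReal.ofReal_one, one_mul]

theorem exists_dilation {L : Matrix (Fin d) (Fin d) ℝ} (hL : L.det ≠ 0) {z : ℂ}
    (hz : ‖z‖ = √|L.det|) : ∃ U : L2 d ≃ₗᵢ[ℂ] L2 d, ∀ f : L2 d,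
      U f =ᵐ[volume] fun x => z * f (WithLp.toLp 2 (L *ᵥ x.ofLp)) := by
  have hm : ∀ (M : Matrix (Fin d) (Fin d) ℝ) (_ : M.det ≠ 0) (y : ℂ) (_ : ‖y‖ = √|M.det|)
      (f : L2 d), MemLp (fun x => y * f (Matrix.toLpLin 2 2 M x)) 2 volume :=
    fun M hM y hy f => ⟨((Lp.aestronglyMeasurable f).comp_quasiMeasurePreserving
      (quasiMeasurePreserving_toLpLin hM)).const_mul y, by
        rw [eLpNorm_dilation hM hy]; exact (Lp.memLp f).2⟩
  have hL' : (L⁻¹).det ≠ 0 := by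
    rw [Matrix.det_nonsing_inv, Ring.inverse_eq_inv']
    exact inv_ne_zero hL
  have hz0 : z ≠ 0 := by
    rw [← norm_ne_zero_iff, hz]
    exact (Real.sqrt_pos.mpr (abs_pos.mpr hL)).ne'
  have hz' : ‖z⁻¹‖ = √|(L⁻¹).det| := by
    rw [norm_inv, hz, Matrix.det_nonsing_inv, Ring.inverse_eq_inv', abs_inv, Real.sqrt_inv]
  let T := weightedComp (fun _ => z) _ (quasiMeasurePreserving_toLpLin hL) (hm L hL z hz)
    (eLpNorm_dilation hL hz)
  let T' := weightedComp (fun _ => z⁻¹) _ (quasiMeasurePreserving_toLpLin hL') (hm _ hL' _ hz')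
    (eLpNorm_dilation hL' hz')
  have hT : Function.Surjective T := fun f => ⟨T' f, by
    refine Lp.ext ?_
    filter_upwards [weightedComp_ae (fun _ => z) _ (quasiMeasurePreserving_toLpLin hL)
        (hm L hL z hz) (eLpNorm_dilation hL hz) (T' f),
      (quasiMeasurePreserving_toLpLin hL).ae_eq_comp (weightedComp_ae (fun _ => z⁻¹) _
        (quasiMeasurePreserving_toLpLin hL') (hm _ hL' _ hz') (eLpNorm_dilation hL' hz') f)]
      with x h1 h2
    simp only [Function.comp_apply] at h2
    have h3 : Matrix.toLpLin 2 2 L⁻¹ (Matrix.toLpLin 2 2 L x) = x := by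
      rw [Matrix.toLpLin_apply, Matrix.toLpLin_apply, Matrix.mulVec_mulVec,
        Matrix.nonsing_inv_mul _ (isUnit_iff_ne_zero.mpr hL), Matrix.one_mulVec]
    rw [h1, h2, h3, ← mul_assoc, mul_inv_cancel₀ hz0, one_mul]⟩
  exact ⟨LinearIsometryEquiv.ofSurjective T hT, weightedComp_ae (fun _ => z) _
    (quasiMeasurePreserving_toLpLin hL) (hm L hL z hz) (eLpNorm_dilation hL hz)⟩

open scoped FourierTransform in
theorem exists_fourier {ħ : ℝ} (hħ : 0 < ħ) : ∃ U : L2 d ≃ₗᵢ[ℂ] L2 d, ∀ f : Sch d,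
    U (f.toLp 2 volume) =ᵐ[volume] fun x =>
      ((2 * Real.pi * ħ * Complex.I : ℂ) ^ ((d : ℂ) / 2))⁻¹ *
        ∫ y, Complex.exp (-(Complex.I / (ħ : ℂ)) * ((inner ℝ x y : ℝ) : ℂ)) * f y := by
  have hpos : 0 < 2 * Real.pi * ħ := by positivity
  -- Rescaling by `(2πħ)⁻¹` converts the kernel `e^{-2πi x·y}` into `e^{-(i/ħ) x·y}`, and the
  -- prefactor `(2πħi)^{-d/2}` has exactly the modulus `√|det L|` that makes the dilation unitary.
  let L : Matrix (Fin d) (Fin d) ℝ := (2 * Real.pi * ħ)⁻¹ • 1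
  have hdet : L.det = (2 * Real.pi * ħ)⁻¹ ^ d := by simp [L]
  have hL : L.det ≠ 0 := by
    rw [hdet]
    positivity
  have hz : ‖((2 * Real.pi * ħ * Complex.I : ℂ) ^ ((d : ℂ) / 2))⁻¹‖ = √|L.det| := by
    have h1 : ((d : ℂ) / 2) = (((d : ℝ) / 2 : ℝ) : ℂ) := by push_cast; rfl
    have h2 : (2 * Real.pi * ħ * Complex.I : ℂ) = ((2 * Real.pi * ħ : ℝ) : ℂ) * Complex.I := by
      push_cast; rfl
    rw [norm_inv, h1, Complex.norm_cpow_real, h2, norm_mul, Complex.norm_I, mul_one,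
      Complex.norm_real, Real.norm_of_nonneg hpos.le, hdet, abs_of_pos (by positivity),
      Real.sqrt_eq_rpow, ← Real.rpow_natCast, ← Real.rpow_mul (by positivity),
      Real.inv_rpow hpos.le]
    congr 2
    ring
  obtain ⟨D, hD⟩ := exists_dilation hL hz
  refine ⟨D * Lp.fourierTransformₗᵢ (Conf d) ℂ, fun f => ?_⟩
  have h1 : (D * Lp.fourierTransformₗᵢ (Conf d) ℂ) (f.toLp 2 volume) =
      D ((𝓕 f).toLp 2 volume) := by
    rw [← SchwartzMap.toLp_fourier_eq]
    rfl
  rw [h1]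
  filter_upwards [hD ((𝓕 f).toLp 2 volume), (quasiMeasurePreserving_toLpLin hL).ae_eq_comp
    ((𝓕 f).coeFn_toLp 2 volume)] with x h2 h3
  simp only [Function.comp_apply, Matrix.toLpLin_apply] at h3
  rw [h2, h3, SchwartzMap.fourier_coe, Real.fourier_eq']
  congr 2
  funext y
  rw [smul_eq_mul]
  congr 2
  have h4 : WithLp.toLp 2 (L *ᵥ x.ofLp) = (2 * Real.pi * ħ)⁻¹ • x := by
    rw [Matrix.smul_mulVec, Matrix.one_mulVec]
    rfl
  have hħ' : (ħ : ℂ) ≠ 0 := by exact_mod_cast hħ.ne'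
  have hpi : (Real.pi : ℂ) ≠ 0 := by exact_mod_cast Real.pi_ne_zero
  rw [h4, inner_smul_right, real_inner_comm]
  push_cast
  field_simp

/-! ### Generators and factorization of symplectic matrices -/

variable {ħ : ℝ}

theorem exists_isMetaplectic_bigJ (hħ : 0 < ħ) :
    ∃ U : L2 d ≃ₗᵢ[ℂ] L2 d, IsMetaplectic ħ U (bigJ d ℝ) :=
  (exists_fourier hħ).imp fun U hU => .fourier U hU

theorem exists_isMetaplectic_lower (ħ : ℝ) {R : Matrix (Fin d) (Fin d) ℝ} (hR : R.IsSymm) :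
    ∃ U : L2 d ≃ₗᵢ[ℂ] L2 d, IsMetaplectic ħ U (Matrix.fromBlocks 1 0 R 1) := by
  obtain ⟨U, hU⟩ := exists_mul_unimodular (d := d) (w := fun x =>
    Complex.exp (Complex.I / (2 * (ħ : ℂ)) * ((x.ofLp ⬝ᵥ R *ᵥ x.ofLp : ℝ) : ℂ)))
    (by
      simp only [dotProduct, Matrix.mulVec]
      fun_prop)
    (fun x => by
      have : Complex.I / (2 * (ħ : ℂ)) * ((x.ofLp ⬝ᵥ R *ᵥ x.ofLp : ℝ) : ℂ) =
          (((x.ofLp ⬝ᵥ R *ᵥ x.ofLp) / (2 * ħ) : ℝ) : ℂ) * Complex.I := by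
        push_cast
        ring
      rw [this, Complex.norm_exp_ofReal_mul_I])
  exact ⟨U, .chirp U R hR hU⟩

theorem exists_isMetaplectic_diag (ħ : ℝ) {L : Matrix (Fin d) (Fin d) ℝ} (hL : L.det ≠ 0) :
    ∃ U : L2 d ≃ₗᵢ[ℂ] L2 d, IsMetaplectic ħ U (Matrix.fromBlocks L⁻¹ 0 0 Lᵀ) := by
  let m : ℤ := if 0 < L.det then 0 else 1
  have hm : Even m ↔ 0 < L.det := by
    simp only [m]
    split_ifs with h <;> simp [h]
  obtain ⟨U, hU⟩ := exists_dilation hL (z := Complex.I ^ m * ((√|L.det| : ℝ) : ℂ)) (by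
    rw [norm_mul, norm_zpow, Complex.norm_I, one_zpow, one_mul, Complex.norm_real,
      Real.norm_of_nonneg (Real.sqrt_nonneg _)])
  exact ⟨U, .dilation U L hL m hm hU⟩

/-- Conjugation by `J` turns the lower shear with `-R` into the upper shear with `R`. -/
theorem exists_isMetaplectic_upper (hħ : 0 < ħ) {R : Matrix (Fin d) (Fin d) ℝ} (hR : R.IsSymm) :
    ∃ U : L2 d ≃ₗᵢ[ℂ] L2 d, IsMetaplectic ħ U (Matrix.fromBlocks 1 R 0 1) := by
  obtain ⟨U, hU⟩ := exists_isMetaplectic_bigJ (d := d) hħ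
  obtain ⟨V, hV⟩ := exists_isMetaplectic_lower ħ (R := -R) (by rw [Matrix.IsSymm, Matrix.transpose_neg, hR])
  refine ⟨U * V * U⁻¹, ?_⟩
  have h := (hU.mul _ _ _ _ hV).mul _ _ _ _ hU.inv
  have hJ : (bigJ d ℝ)⁻¹ = -bigJ d ℝ :=
    Matrix.inv_eq_right_inv (by rw [Matrix.mul_neg, bigJ_mul_bigJ, neg_neg])
  rw [hJ] at h
  convert h using 1
  simp [bigJ, Matrix.fromBlocks_multiply, Matrix.fromBlocks_neg]

/-- Block elimination writes `S` as the lower shear with `CA⁻¹`, times the diagonal block matrix of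
`A` and `A⁻ᵀ`, times the upper shear with `A⁻¹B`. The symplectic relations make both shear matrices
symmetric and give the lower right block through `AᵀD = 1 + CᵀB`. -/
theorem exists_isMetaplectic_of_det_ne_zero (hħ : 0 < ħ) {A B C D : Matrix (Fin d) (Fin d) ℝ}
    (hS : Matrix.fromBlocks A B C D ∈ Matrix.symplecticGroup (Fin d) ℝ) (hA : A.det ≠ 0) :
    ∃ U : L2 d ≃ₗᵢ[ℂ] L2 d, IsMetaplectic ħ U (Matrix.fromBlocks A B C D) := by
  have hAu := isUnit_iff_ne_zero.mpr hA
  have hAt : IsUnit Aᵀ.det := by rwa [Matrix.det_transpose]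
  have h1 := transpose_mul_bigJ_mul hS
  have h2 := transpose_mul_bigJ_mul (SymplecticGroup.transpose_mem hS)
  rw [Matrix.transpose_transpose] at h2
  rw [bigJ, Matrix.fromBlocks_transpose, Matrix.fromBlocks_multiply, Matrix.fromBlocks_multiply,
    Matrix.fromBlocks_inj] at h1 h2
  simp only [Matrix.mul_zero, Matrix.mul_one, Matrix.mul_neg, zero_add, add_zero,
    Matrix.neg_mul] at h1 h2
  have hAC : Cᵀ * A = Aᵀ * C := neg_add_eq_zero.mp h1.1
  have hAB : B * Aᵀ = A * Bᵀ := neg_add_eq_zero.mp h2.1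
  have hAD : Aᵀ * D = 1 + Cᵀ * B := by
    rw [← h1.2.1]
    abel
  have hR : (C * A⁻¹).IsSymm := by
    rw [Matrix.IsSymm, Matrix.transpose_mul, Matrix.transpose_nonsing_inv]
    calc (Aᵀ)⁻¹ * Cᵀ = (Aᵀ)⁻¹ * (Cᵀ * A) * A⁻¹ := by
          rw [Matrix.mul_assoc, Matrix.mul_assoc, Matrix.mul_nonsing_inv _ hAu, Matrix.mul_one]
      _ = C * A⁻¹ := by
          rw [hAC, ← Matrix.mul_assoc, Matrix.nonsing_inv_mul _ hAt, Matrix.one_mul]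
  have hT : (A⁻¹ * B).IsSymm := by
    rw [Matrix.IsSymm, Matrix.transpose_mul, Matrix.transpose_nonsing_inv]
    calc Bᵀ * (Aᵀ)⁻¹ = A⁻¹ * (A * Bᵀ) * (Aᵀ)⁻¹ := by
          rw [← Matrix.mul_assoc, Matrix.nonsing_inv_mul _ hAu, Matrix.one_mul]
      _ = A⁻¹ * B := by
          rw [← hAB, Matrix.mul_assoc, Matrix.mul_assoc, Matrix.mul_nonsing_inv _ hAt,
            Matrix.mul_one]
  obtain ⟨U₁, h₁⟩ := exists_isMetaplectic_lower ħ hR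
  obtain ⟨U₂, h₂⟩ := exists_isMetaplectic_diag ħ (L := A⁻¹) (by
    rw [Matrix.det_nonsing_inv, Ring.inverse_eq_inv']
    exact inv_ne_zero hA)
  obtain ⟨U₃, h₃⟩ := exists_isMetaplectic_upper hħ hT
  refine ⟨U₁ * U₂ * U₃, ?_⟩
  convert (h₁.mul _ _ _ _ h₂).mul _ _ _ _ h₃ using 1
  rw [Matrix.nonsing_inv_nonsing_inv _ hAu, Matrix.fromBlocks_multiply, Matrix.fromBlocks_multiply]
  have hCA : C * A⁻¹ * A = C := by
    rw [Matrix.mul_assoc, Matrix.nonsing_inv_mul _ hAu, Matrix.mul_one]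
  have hAAB : A * (A⁻¹ * B) = B := by
    rw [← Matrix.mul_assoc, Matrix.mul_nonsing_inv _ hAu, Matrix.one_mul]
  have hD : D = C * (A⁻¹ * B) + A⁻¹ᵀ := by
    rw [← Matrix.mul_assoc, ← hR, Matrix.transpose_mul, Matrix.mul_assoc]
    nth_rw 2 [← Matrix.mul_one A⁻¹ᵀ]
    rw [← Matrix.mul_add, add_comm, ← hAD, ← Matrix.mul_assoc, ← Matrix.transpose_mul,
      Matrix.mul_nonsing_inv _ hAu, Matrix.transpose_one, Matrix.one_mul]
  simp only [Matrix.mul_zero, Matrix.mul_one, Matrix.zero_mul, Matrix.one_mul, zero_add, add_zero,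
    hCA, hAAB, ← hD]

/-- `det(A + tC)` is a polynomial in `t`. At `t = i` it is the determinant of the matrix `Q`
belonging to `Sᵀ`, hence nonzero, so it cannot vanish at every real `t`. -/
theorem exists_det_add_smul_ne_zero {A B C D : Matrix (Fin d) (Fin d) ℝ}
    (hS : Matrix.fromBlocks A B C D ∈ Matrix.symplecticGroup (Fin d) ℝ) :
    ∃ t : ℝ, (A + t • C).det ≠ 0 := by
  by_contra! h
  let f : Polynomial ℝ := (A.map Polynomial.C + (Polynomial.X : Polynomial ℝ) • C.map Polynomial.C).det
  have h1 : f = 0 := Polynomial.funext fun t => by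
    rw [Polynomial.eval_zero, ← h t, ← Polynomial.coe_evalRingHom, RingHom.map_det]
    congr 1
    ext i j
    simp
    ring
  have h2 : Polynomial.eval₂ Complex.ofRealHom Complex.I f = 0 := by
    rw [h1, Polynomial.eval₂_zero]
  rw [← Polynomial.coe_eval₂RingHom, RingHom.map_det] at h2
  refine det_Qmat_ne_zero (SymplecticGroup.transpose_mem hS) ?_
  rw [← Matrix.det_transpose, ← h2]
  congr 1
  ext i j
  simp [Qmat, Matrix.toBlocks₁₁, Matrix.toBlocks₁₂]
  ring

theorem exists_isMetaplectic (hħ : 0 < ħ) {S : Matrix (Phase d) (Phase d) ℝ}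
    (hS : S ∈ Matrix.symplecticGroup (Fin d) ℝ) :
    ∃ U : L2 d ≃ₗᵢ[ℂ] L2 d, IsMetaplectic ħ U S := by
  rw [← Matrix.fromBlocks_toBlocks S] at hS ⊢
  generalize S.toBlocks₁₁ = A at *
  generalize S.toBlocks₁₂ = B at *
  generalize S.toBlocks₂₁ = C at *
  generalize S.toBlocks₂₂ = D at *
  obtain ⟨t, ht⟩ := exists_det_add_smul_ne_zero hS
  have hsymm : ∀ r : ℝ, (r • (1 : Matrix (Fin d) (Fin d) ℝ)).IsSymm := fun r => by
    rw [Matrix.IsSymm, Matrix.transpose_smul, Matrix.transpose_one]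
  have hup : Matrix.fromBlocks 1 (t • 1) 0 1 ∈ Matrix.symplecticGroup (Fin d) ℝ := by
    rw [SymplecticGroup.mem_iff, Matrix.J, Matrix.fromBlocks_transpose, Matrix.fromBlocks_multiply,
      Matrix.fromBlocks_multiply]
    simp
  have hS' := Submonoid.mul_mem _ hup hS
  have h1 : Matrix.fromBlocks 1 (t • 1) 0 1 * Matrix.fromBlocks A B C D =
      Matrix.fromBlocks (A + t • C) (B + t • D) C D := by
    simp [Matrix.fromBlocks_multiply]
  rw [h1] at hS'
  obtain ⟨U, hU⟩ := exists_isMetaplectic_of_det_ne_zero hħ hS' ht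
  -- The upper shear with `-t` undoes the one that made the upper left block invertible.
  obtain ⟨V, hV⟩ := exists_isMetaplectic_upper (d := d) hħ (hsymm (-t))
  refine ⟨V * U, ?_⟩
  convert hV.mul _ _ _ _ hU using 1
  simp [Matrix.fromBlocks_multiply]

end Hagedorn

end

theorem mainTheorem5 (d : ℕ) (ħ : ℝ) (hħ : 0 < ħ)
    (S : Matrix (Fin d ⊕ Fin d) (Fin d ⊕ Fin d) ℝ)
    (hS : S ∈ Matrix.symplecticGroup (Fin d) ℝ)
    (q p : EuclideanSpace ℝ (Fin d)) :
    (∃ Shat : Hagedorn.L2 d ≃ₗᵢ[ℂ] Hagedorn.L2 d, Hagedorn.IsMetaplectic ħ Shat S) ∧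
    (∀ Shat : Hagedorn.L2 d ≃ₗᵢ[ℂ] Hagedorn.L2 d, Hagedorn.IsMetaplectic ħ Shat S →
      ∃ φ : HilbertBasis (Fin d → ℕ) ℂ (Hagedorn.L2 d),
        Hagedorn.IsGeneratedBy (Hagedorn.raisingConj ħ Shat q p)
          (Hagedorn.groundConj hħ Shat q p) φ ∧
        ∀ φ' : (Fin d → ℕ) → Hagedorn.L2 d,
          Hagedorn.IsGeneratedBy (Hagedorn.raisingConj ħ Shat q p)
            (Hagedorn.groundConj hħ Shat q p) φ' → φ' = φ) ∧
    (∀ c : ℂ, c ^ 2 = ((Hagedorn.Qmat S).det)⁻¹ →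
      ∃ hc : MemLp (Hagedorn.groundGaussian ħ S q p c) 2 volume,
        ∃ φ : HilbertBasis (Fin d → ℕ) ℂ (Hagedorn.L2 d),
          Hagedorn.IsGeneratedBy (Hagedorn.raisingSymp ħ S q p) (hc.toLp _) φ ∧
          ∀ φ' : (Fin d → ℕ) → Hagedorn.L2 d,
            Hagedorn.IsGeneratedBy (Hagedorn.raisingSymp ħ S q p) (hc.toLp _) φ' →
              φ' = φ) := by
  refine ⟨Hagedorn.exists_isMetaplectic hħ hS, fun Shat _ => ?_, fun c hc => ?_⟩
  · obtain ⟨φ, hφ⟩ := Hagedorn.exists_basis_conj hħ Shat q p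
    exact ⟨φ, hφ, fun φ' hφ' => hφ.unique hφ'⟩
  · obtain ⟨hmem, φ, hφ⟩ := Hagedorn.exists_basis_symp hħ hS q p hc
    exact ⟨hmem, φ, hφ, fun φ' hφ' => hφ.unique hφ'⟩
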